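/- **Setting.** Let $n,d\in\mathbb N$. Consider circuits on $n$ qubits that are arbitrary finite sequences of gates of two kinds: *encoding gates* $\exp(-\mathrm i\,x^{(i)}H)$, where $x^{(i)}$ is a coordinate of the input $x\in[0,2\pi)^d$ and $H$ is a Hermitian operator, and *trainable gates*, i.e. unitaries $W(\theta)$ depending in an arbitrary way on parameters $\theta\in\Theta$ ($\Theta$ an arbitrary set). A *data-encoding strategy* $\mathcal D=(\mathcal D^{(1)},\dots,\mathcal D^{(d)})$ gives for each $i$ a finite family (repetitions allowed) $\mathcal D^{(i)}=(H^{(i)}_j)_{j=1}^{N^{(i)}}$ of Hamiltonians; $N=\sum_iN^{(i)}$ is the total number of encoding gates. Write $U_\theta(x)\sim\mathcal D$ if, for each $i$, the Hamiltonians of the gates of the circuit encoding $x^{(i)}$ are exactly those of $\mathcal D^{(i)}$, with multiplicities, in any order and placement. For an observable (Hermitian operator) $M$ with operator norm $\|M\|_\infty$ let $$\mathcal F_{\Theta,\mathcal D,M}=\{\,x\mapsto\langle0|U_\theta(x)^\dagger M\,U_\theta(x)|0\rangle \;:\; \theta\in\Theta,\ U_\theta(x)\sim\mathcal D\,\}$$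 (the class over all circuits using $\mathcal D$; it contains the class of each fixed circuit). For a Hermitian $H$ let $\Delta(H)=\{\lambda-\mu:\lambda,\mu\in\operatorname{spec}(H)\}$; $H$ has *integer frequencies* if $\Delta(H)\subseteq\mathbb Z$. The frequency set of $\mathcal D$ is the Minkowski sum $$\Omega=\Omega(\mathcal D)=\sum_{i=1}^d\sum_{j=1}^{N^{(i)}}\{\delta\,e^{(i)}:\delta\in\Delta(H^{(i)}_j)\}\subset\mathbb R^d .$$ A Hamiltonian is *$\kappa$-local* if it acts as the identity outside some set of at most $\kappa$ qubits. For a loss $\ell$ and a probability measure $P$ on $[0,2\pi)^d\times\mathbb R$ put $R(f)=\int\ell(y,f(x))\,\mathrm dP(x,y)$ and, for $S=((x_j,y_j))_{j=1}^m$, $\hat R_S(f)=\frac1m\sum_{j=1}^m\ell(y_j,f(x_j))$. **Statement.** There are a universal constant $C$ and constants $A_1$, $B_1(d)$, $A_2(T)$, $B_2(T,d)$, $A_3(\kappa)$, $B_3(\kappa,d)$, depending only on the displayed arguments, such that the following holds for all $\Theta,n,d,\mathcal D,M$, all $m\ge1$, all measurable $\ell:\mathbb R\times\mathbb R\to[0,c]$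 such that $z\mapsto\ell(y,z)$ is $L$-Lipschitz for every $y$, all probability measures $P$ on $[0,2\pi)^d\times\mathbb R$ and all $\delta\in(0,1)$. Put $K_1=A_1^d$ if $N\ge d$ and $K_1=B_1(d)$ otherwise; $K_2=A_2(T)^d$ if $N\ge d$ and $K_2=B_2(T,d)$ otherwise; $K_3=A_3(\kappa)^d$ if $N\ge d$ and $K_3=B_3(\kappa,d)$ otherwise. Each bound on $R(f)-\hat R_S(f)$ below holds, with probability at least $1-\delta$ over the choice of i.i.d. training data $S\sim P^m$, simultaneously for all $f\in\mathcal F_{\Theta,\mathcal D,M}$. 0. If all Hamiltonians of $\mathcal D$ have integer frequencies, then $$R(f)-\hat R_S(f)\le C\Big(\frac{L\|M\|_\infty}{\sqrt m}\sqrt{|\Omega|}+c\sqrt{\frac{\log(1/\delta)}m}\Big).$$ 1. (a) If $N\ge1$ and all Hamiltonians of $\mathcal D$ are tensor products of Pauli operators from $\{I,X,Y,Z\}$, then $|\Omega|\le K_1\,(N/d)^d$ and $$R(f)-\hat R_S(f)\le K_1\frac{L\|M\|_\infty}{\sqrt m}\Big(\frac Nd\Big)^{d/2}+C\,c\sqrt{\frac{\log(1/\delta)}m}.$$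 2. (b) If $N\ge1$, $T\ge1$ and for each $i$ all members of $\mathcal D^{(i)}$ equal one and the same Hamiltonian $H^{(i)}$ with integer frequencies $\Delta(H^{(i)})=\{0,\pm\delta_1,\dots,\pm\delta_{T'}\}$, $T'\le T$ (i.e. $|\Delta(H^{(i)})|\le2T+1$), then $|\Omega|\le K_2\,(N^{2T-1}/d)^d$ and $$R(f)-\hat R_S(f)\le K_2\frac{L\|M\|_\infty}{\sqrt m}\Big(\frac{N^{2T-1}}d\Big)^{d/2}+C\,c\sqrt{\frac{\log(1/\delta)}m}.$$ 3. (c) If $N\ge1$, $\kappa\ge0$ and for each $i$ all members of $\mathcal D^{(i)}$ equal one and the same $\kappa$-local Hamiltonian $H^{(i)}$ with integer frequencies, then $|\Omega|\le K_3\,(N^{2^{\kappa+1}-1}/d)^d$ and $$R(f)-\hat R_S(f)\le K_3\frac{L\|M\|_\infty}{\sqrt m}\Big(\frac{N^{2^{\kappa+1}-1}}d\Big)^{d/2}+C\,c\sqrt{\frac{\log(1/\delta)}m}.$$ 4. (d) If $\kappa\ge0$ and all Hamiltonians of $\mathcal D$ are (possibly different) $\kappa$-local Hamiltonians with integer frequencies,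 then $|\Omega|\le2^{2\kappa N}$ and $$R(f)-\hat R_S(f)\le C\Big(\frac{L\|M\|_\infty}{\sqrt m}\,2^{\kappa N}+c\sqrt{\frac{\log(1/\delta)}m}\Big).$$ -/

import Mathlib

open MeasureTheory Set
open scoped Pointwise

noncomputable section

namespace PQC

/-! ### Operators on `n` qubits -/

/-- Labels of the computational basis of `n` qubits. -/
abbrev Bits (n : ℕ) : Type := Fin n → Fin 2

/-- Hermitian operators on `n` qubits (Hamiltonians and observables). -/
abbrev HermOp (n : ℕ) : Type := {H : Matrix (Bits n) (Bits n) ℂ // H.IsHermitian}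

/-- The operator norm with respect to the Euclidean norm of `ℂ^(2^n)`. -/
def opNorm {n : ℕ} (M : HermOp n) : ℝ :=
  ‖Matrix.toEuclideanCLM (𝕜 := ℂ) M.1‖

/-- The real spectrum (set of eigenvalues) of a Hermitian operator. -/
def spec {n : ℕ} (H : HermOp n) : Set ℝ := spectrum ℝ H.1

/-- The set `Δ(H)` of differences of eigenvalues of `H`. -/
def diffs {n : ℕ} (H : HermOp n) : Set ℝ :=
  {r | ∃ a ∈ spec H, ∃ b ∈ spec H, r = a - b}

/-- All differences of eigenvalues of `H` are integers. -/
def HasIntegerFrequencies {n : ℕ} (H : HermOp n) : Prop :=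
  ∀ r ∈ diffs H, ∃ k : ℤ, r = k

/-- The four one-qubit Pauli operators `I, X, Y, Z`. -/
def pauli : Fin 4 → Matrix (Fin 2) (Fin 2) ℂ :=
  ![!![1, 0; 0, 1], !![0, 1; 1, 0], !![0, -Complex.I; Complex.I, 0], !![1, 0; 0, -1]]

/-- `H` is a tensor product of one-qubit Pauli operators. -/
def IsPauliString {n : ℕ} (H : HermOp n) : Prop :=
  ∃ p : Fin n → Fin 4, ∀ a b : Bits n, H.1 a b = ∏ k, pauli (p k) (a k) (b k)

open Classical in
/-- `H` is `κ`-local: it is of the form `h ⊗ 1`, with `h` acting on a set `s` of at most `κ`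
qubits and the identity acting on all the other qubits. -/
def IsLocal {n : ℕ} (κ : ℕ) (H : HermOp n) : Prop :=
  ∃ s : Finset (Fin n), s.card ≤ κ ∧
    ∃ h : Matrix (s → Fin 2) (s → Fin 2) ℂ, ∀ a b : Bits n,
      H.1 a b = if ∀ k ∉ s, a k = b k then h (fun k => a k) (fun k => b k) else 0

/-! ### Data-encoding strategies and their frequencies -/

/-- A data-encoding strategy `𝒟 = (𝒟⁽¹⁾, …, 𝒟⁽ᵈ⁾)`: for each data coordinate the family, with
repetitions, of the Hamiltonians of the gates that encode this coordinate. -/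
abbrev Encoding (n d : ℕ) : Type := Fin d → Multiset (HermOp n)

/-- The total number `N` of data-encoding gates. -/
def Encoding.numGates {n d : ℕ} (D : Encoding n d) : ℕ := ∑ i, Multiset.card (D i)

/-- The frequency vectors `(λ - μ) eᵢ`, with `λ, μ` in the spectrum of `H`. -/
def gateFrequencies {n d : ℕ} (i : Fin d) (H : HermOp n) : Set (Fin d → ℝ) :=
  (fun r : ℝ => (Pi.single i r : Fin d → ℝ)) '' diffs H

/-- The frequency set `Ω(𝒟)`: the Minkowski sum of the frequency sets of all encoding gates. -/
def Encoding.frequencies {n d : ℕ} (D : Encoding n d) : Set (Fin d → ℝ) :=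
  ∑ i, ((D i).map (gateFrequencies i)).sum

/-- The frequency set is finite, so that `Set.ncard` counts its elements. -/
theorem Encoding.frequencies_finite {n d : ℕ} (D : Encoding n d) : D.frequencies.Finite := by
  have hg : ∀ (i : Fin d) (H : HermOp n), (gateFrequencies i H).Finite := by
    intro i H
    refine Set.Finite.image _ ?_
    have hs : (spec H).Finite := by
      unfold spec
      rw [H.2.spectrum_real_eq_range_eigenvalues]
      exact Set.finite_range _
    refine (hs.sub hs).subset ?_
    rintro r ⟨a, ha, b, hb, rfl⟩
    exact Set.sub_mem_sub ha hb
  have hm : ∀ (i : Fin d) (s : Multiset (HermOp n)),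
      ((s.map (gateFrequencies i)).sum).Finite := by
    intro i s
    induction s using Multiset.induction_on with
    | empty => simp
    | cons H s ih =>
      rw [Multiset.map_cons, Multiset.sum_cons]
      exact (hg i H).add ih
  exact Finset.sum_induction _ (fun s : Set (Fin d → ℝ) => s.Finite)
    (fun _ _ h h' => h.add h') (by simp) (fun i _ => hm i (D i))

/-! ### Parametrized quantum circuits -/

/-- The data domain `[0, 2π)^d`. -/
abbrev Inputs (d : ℕ) : Type := Fin d → Set.Ico (0 : ℝ) (2 * Real.pi)

/-- A gate of the circuit: either a data-encoding gate, given by a data coordinate and a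
Hamiltonian, or a trainable gate, given by a unitary that depends on the trainable parameters. -/
inductive Gate (n d : ℕ) (Θ : Type*) where
  | encode (i : Fin d) (H : HermOp n) : Gate n d Θ
  | trainable (W : Θ → Matrix.unitaryGroup (Bits n) ℂ) : Gate n d Θ

/-- The operator implemented by a gate; the gate `encode i H` implements `exp(-i x⁽ⁱ⁾ H)`. -/
def Gate.operator {n d : ℕ} {Θ : Type*} (θ : Θ) (x : Inputs d) :
    Gate n d Θ → Matrix (Bits n) (Bits n) ℂ
  | .encode i H => NormedSpace.exp ((-Complex.I * ((x i : ℝ) : ℂ)) • H.1)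
  | .trainable W => (W θ : Matrix (Bits n) (Bits n) ℂ)

/-- The Hamiltonian of a gate, if this gate encodes the data coordinate `i`. -/
def Gate.hamiltonian? {n d : ℕ} {Θ : Type*} (i : Fin d) : Gate n d Θ → Option (HermOp n)
  | .encode j H => if j = i then some H else none
  | .trainable _ => none

/-- A circuit: an arbitrary finite sequence of encoding and trainable gates, listed from the gate
that is applied last to the gate that is applied first. -/
abbrev Circuit (n d : ℕ) (Θ : Type*) : Type _ := List (Gate n d Θ)

/-- The operator `U_θ(x)` implemented by the circuit. -/
def Circuit.operator {n d : ℕ} {Θ : Type*} (U : Circuit n d Θ) (θ : Θ) (x : Inputs d) :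
    Matrix (Bits n) (Bits n) ℂ :=
  (List.map (Gate.operator θ x) U).prod

/-- `U ∼ 𝒟`: for every coordinate, the Hamiltonians of the gates of `U` that encode it are, with
multiplicities, the ones of the data-encoding strategy. -/
def Circuit.Uses {n d : ℕ} {Θ : Type*} (U : Circuit n d Θ) (D : Encoding n d) : Prop :=
  ∀ i, ((List.filterMap (Gate.hamiltonian? i) U : List (HermOp n)) : Multiset (HermOp n)) = D i

/-- The model output `⟨0| U_θ(x)† M U_θ(x) |0⟩`, a real number as `M` is Hermitian. -/
def Circuit.output {n d : ℕ} {Θ : Type*} (U : Circuit n d Θ) (M : HermOp n) (θ : Θ)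
    (x : Inputs d) : ℝ :=
  (((U.operator θ x).conjTranspose * M.1 * U.operator θ x) 0 0).re

/-- The model class `{x ↦ ⟨0| U_θ(x)† M U_θ(x) |0⟩ | θ ∈ Θ, U_θ(x) ∼ 𝒟}`. It contains the class of
each fixed circuit that uses the strategy `𝒟`. -/
def modelClass {n d : ℕ} (Θ : Type*) (D : Encoding n d) (M : HermOp n) : Set (Inputs d → ℝ) :=
  {f | ∃ (U : Circuit n d Θ) (θ : Θ), U.Uses D ∧ f = U.output M θ}

/-! ### Risks and generalization bounds -/

/-- The expected risk of the hypothesis `f`. -/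
def risk {d : ℕ} (l : ℝ → ℝ → ℝ) (P : Measure (Inputs d × ℝ)) (f : Inputs d → ℝ) : ℝ :=
  ∫ z, l z.2 (f z.1) ∂P

/-- The empirical risk of the hypothesis `f` on the sample `S`. -/
def empRisk {d m : ℕ} (l : ℝ → ℝ → ℝ) (S : Fin m → Inputs d × ℝ) (f : Inputs d → ℝ) : ℝ :=
  (1 / (m : ℝ)) * ∑ j, l (S j).2 (f (S j).1)

/-- With probability at least `1 - δ` over an i.i.d. sample of size `m` from `P`, all hypotheses in
`F` have generalization gap at most `ε`. -/
def GapBound {d : ℕ} (F : Set (Inputs d → ℝ)) (l : ℝ → ℝ → ℝ) (P : Measure (Inputs d × ℝ))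
    (m : ℕ) (δ ε : ℝ) : Prop :=
  ENNReal.ofReal (1 - δ) ≤ Measure.pi (fun _ : Fin m => P)
    {S : Fin m → Inputs d × ℝ | ∀ f ∈ F, risk l P f - empRisk l S f ≤ ε}

/-- The hidden constant of a bound for `d` coordinates and `N` encoding gates: it is `A ^ d` if
there are at least as many gates as coordinates, and otherwise a constant `B` (for us, one that
may depend on `d` in an arbitrary way). -/
def hiddenConst (A B : ℝ) (d N : ℕ) : ℝ := if d ≤ N then A ^ d else B

end PQC

end

/-! Conjugating an observable by `exp (-i x⁽ⁱ⁾ H)` multiplies its entries, in the eigenbasis of `H`,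
by exponentials of eigenvalue differences, while a trainable gate only mixes entries. Hence every
model is a trigonometric polynomial with frequencies in `Ω`, whatever the order of the gates. Its
modulus is at most `‖M‖` because the circuit is unitary. For integer frequencies, Bessel's
inequality then bounds the `ℓ²` norm of the coefficients by `‖M‖`. So models are linear functionals
of weight at most `‖M‖` on the feature map of all characters in `Ω`, whose norm is `√|Ω|`
(`exists_weights_of_mem_modelClass`).

For such a linear class, McDiarmid's inequality reduces the uniform deviation to its mean. The mean
is bounded by exchanging samples one at a time for random signs (`integral_offsetGap_le`):
symmetrization, contraction and the parallelogram law are combined in a single induction, with a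
vector offset recording the signed sum so far. The result is `gapBound_of_linear`.

It remains to count `Ω`. It is a sum of sets over the coordinates, so its size is at most a product.
If the differences of one coordinate are `{-1,0,1}`-combinations of `e` generators, then `Nᵢ` gates
produce at most `(2Nᵢ+1)^e` values. AM–GM balances the product when `N ≥ d`; when `N < d` the
constant absorbs everything. The resulting exponents `1`, `T` and `2^κ` are at most the ones
claimed. -/

noncomputable section

namespace PQC

/-! ### Concentration: Hoeffding's lemma and McDiarmid's inequality. -/

section Statistics

variable {Z : Type*} [MeasurableSpace Z]

/-- Integrating over `m + 1` independent samples is integrating over one and then over `m`. -/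
theorem integral_pi_cons (P : Measure Z) [IsProbabilityMeasure P] {m : ℕ}
    (F : (Fin (m + 1) → Z) → ℝ) :
    ∫ S, F S ∂(Measure.pi fun _ => P) =
      ∫ p : Z × (Fin m → Z), F (Fin.cons p.1 p.2) ∂(P.prod (Measure.pi fun _ => P)) := by
  have h := (measurePreserving_piFinSuccAbove (fun _ : Fin (m + 1) => P) 0).symm
  rw [← h.integral_comp']
  simp [MeasurableEquiv.piFinSuccAbove, Fin.insertNthEquiv]

theorem measurable_finCons {m : ℕ} :
    Measurable fun p : Z × (Fin m → Z) => (Fin.cons p.1 p.2 : Fin (m + 1) → Z) := by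
  refine measurable_pi_iff.2 fun j => ?_
  refine Fin.cases ?_ (fun j => ?_) j
  · simpa using measurable_fst
  · simpa [Function.comp_def] using
      (measurable_pi_apply j).comp (measurable_snd (α := Z) (β := Fin m → Z))

theorem integrable_of_measurable_of_abs_le {α : Type*} [MeasurableSpace α] {μ : Measure α}
    [IsFiniteMeasure μ] {F : α → ℝ} (hF : Measurable F) {K : ℝ} (hK : ∀ a, |F a| ≤ K) :
    Integrable F μ :=
  Integrable.of_bound hF.aestronglyMeasurable K (Filter.Eventually.of_forall hK)

/-- Hoeffding's lemma in the form used for bounded differences. -/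
theorem integral_exp_mul_le (P : Measure Z) [IsProbabilityMeasure P] {h : Z → ℝ}
    (hm : Measurable h) {c : ℝ} (hc : ∀ z z', h z - h z' ≤ c) (t : ℝ) :
    ∫ z, Real.exp (t * h z) ∂P ≤ Real.exp (t * ∫ z, h z ∂P + t ^ 2 * c ^ 2 / 8) := by
  obtain ⟨z₀⟩ : Nonempty Z := by
    by_contra hne
    rw [not_nonempty_iff] at hne
    exact IsProbabilityMeasure.ne_zero P (Measure.eq_zero_of_isEmpty P)
  have hc0 : 0 ≤ c := by simpa using hc z₀ z₀
  have hbdd : BddBelow (range h) := ⟨h z₀ - c, by rintro _ ⟨z, rfl⟩; linarith [hc z₀ z]⟩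
  -- Oscillation at most `c` puts the range in an interval of length `c` starting at the infimum,
  -- which is the form Hoeffding's lemma needs.
  have hmem : ∀ z, h z ∈ Set.Icc (⨅ z, h z) ((⨅ z, h z) + c) := by
    intro z
    refine ⟨ciInf_le hbdd z, ?_⟩
    have : h z - c ≤ ⨅ z, h z := by
      have : Nonempty Z := ⟨z₀⟩
      exact le_ciInf fun z' => by linarith [hc z z']
    linarith
  have hs := ProbabilityTheory.hasSubgaussianMGF_of_mem_Icc (μ := P) hm.aemeasurable
    (Filter.Eventually.of_forall hmem)
  have h1 := hs.mgf_le t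
  have h2 : ∫ z, Real.exp (t * h z) ∂P =
      Real.exp (t * ∫ z, h z ∂P) * ProbabilityTheory.mgf (fun z => h z - ∫ z, h z ∂P) P t := by
    rw [ProbabilityTheory.mgf, ← integral_const_mul]
    refine integral_congr_ae (Filter.Eventually.of_forall fun z => ?_)
    simp only
    rw [← Real.exp_add]
    ring_nf
  rw [h2, Real.exp_add]
  refine mul_le_mul_of_nonneg_left (h1.trans (Real.exp_le_exp.2 (le_of_eq ?_)))
    (Real.exp_nonneg _)
  simp [abs_of_nonneg hc0]
  ring

/-- McDiarmid's inequality for the moment generating function of a function whose value changes by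
at most `c` when one of its arguments is changed. -/
theorem integral_exp_mul_pi_le (P : Measure Z) [IsProbabilityMeasure P] {c t K : ℝ} {m : ℕ}
    {F : (Fin m → Z) → ℝ} (hF : Measurable F) (hK : ∀ S, |F S| ≤ K)
    (hd : ∀ S j z, F (Function.update S j z) - F S ≤ c) :
    ∫ S, Real.exp (t * F S) ∂(Measure.pi fun _ => P) ≤
      Real.exp (t * ∫ S, F S ∂(Measure.pi fun _ => P) + t ^ 2 * (m * c ^ 2) / 8) := by
  induction m with
  | zero =>
    have : ∀ G : (Fin 0 → Z) → ℝ, ∫ S, G S ∂(Measure.pi fun _ => P) = G (fun j => j.elim0) := by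
      intro G
      have : G = fun _ => G (fun j => j.elim0) := by
        funext S; congr 1; exact Subsingleton.elim _ _
      rw [this]; simp
    rw [this, this]; simp
  | succ m ih =>
    have hFc : Measurable fun p : Z × (Fin m → Z) => F (Fin.cons p.1 p.2) :=
      hF.comp measurable_finCons
    have hEc : ∀ p : Z × (Fin m → Z), |Real.exp (t * F (Fin.cons p.1 p.2))| ≤
        Real.exp (|t| * K) := by
      intro p
      rw [abs_of_nonneg (Real.exp_nonneg _)]
      refine Real.exp_le_exp.2 ((le_abs_self _).trans ?_)
      rw [abs_mul]
      exact mul_le_mul_of_nonneg_left (hK _) (abs_nonneg _)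
    have hEm : Measurable fun p : Z × (Fin m → Z) => Real.exp (t * F (Fin.cons p.1 p.2)) :=
      (hFc.const_mul t).exp
    rw [integral_pi_cons, integral_pi_cons,
      integral_prod _ (integrable_of_measurable_of_abs_le hEm hEc),
      integral_prod _ (integrable_of_measurable_of_abs_le hFc fun p => hK _)]
    -- The mean of `F` over all samples but the first. Averaging preserves bounded differences, so
    -- Hoeffding applies to `h`, and the induction hypothesis applies to each section of `F`.
    set h : Z → ℝ := fun z => ∫ S, F (Fin.cons z S) ∂(Measure.pi fun _ : Fin m => P) with hh
    have hsec : ∀ z, Measurable fun S : Fin m → Z => F (Fin.cons z S) := fun z =>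
      hFc.comp measurable_prodMk_left
    have hhm : Measurable h :=
      (hFc.stronglyMeasurable.integral_prod_right').measurable
    have hhK : ∀ z, |h z| ≤ K := by
      intro z
      have := norm_integral_le_of_norm_le_const (μ := Measure.pi fun _ : Fin m => P)
        (f := fun S => F (Fin.cons z S)) (C := K) (Filter.Eventually.of_forall fun S => hK _)
      simpa using this
    have hhc : ∀ z z', h z - h z' ≤ c := by
      intro z z'
      rw [hh]
      simp only
      rw [← integral_sub (integrable_of_measurable_of_abs_le (hsec z) fun _ => hK _)
        (integrable_of_measurable_of_abs_le (hsec z') fun _ => hK _)]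
      have : ∀ S : Fin m → Z, F (Fin.cons z S) - F (Fin.cons z' S) ≤ c := by
        intro S
        have := hd (Fin.cons z' S) 0 z
        rwa [Fin.update_cons_zero] at this
      calc _ ≤ ∫ _ : Fin m → Z, c ∂(Measure.pi fun _ => P) := by
            refine integral_mono ?_ (integrable_const _) this
            exact (integrable_of_measurable_of_abs_le (hsec z) fun _ => hK _).sub
              (integrable_of_measurable_of_abs_le (hsec z') fun _ => hK _)
        _ = c := by simp
    have hstep : ∀ z, ∫ S, Real.exp (t * F (Fin.cons z S)) ∂(Measure.pi fun _ : Fin m => P) ≤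
        Real.exp (t * h z) * Real.exp (t ^ 2 * (m * c ^ 2) / 8) := by
      intro z
      rw [← Real.exp_add]
      refine ih (hsec z) (fun _ => hK _) fun S j z' => ?_
      have := hd (Fin.cons z S) j.succ z'
      rwa [← Fin.cons_update] at this
    have hexp : Integrable (fun z => Real.exp (t * h z)) P := by
      refine integrable_of_measurable_of_abs_le (K := Real.exp (|t| * K)) (hhm.const_mul t).exp ?_
      intro z
      rw [abs_of_nonneg (Real.exp_nonneg _)]
      refine Real.exp_le_exp.2 ((le_abs_self _).trans ?_)
      rw [abs_mul]
      exact mul_le_mul_of_nonneg_left (hhK _) (abs_nonneg _)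
    calc ∫ z, ∫ S, Real.exp (t * F (Fin.cons z S)) ∂(Measure.pi fun _ : Fin m => P) ∂P
        ≤ ∫ z, Real.exp (t * h z) * Real.exp (t ^ 2 * (m * c ^ 2) / 8) ∂P :=
          integral_mono_of_nonneg
            (Filter.Eventually.of_forall fun z => integral_nonneg fun S => Real.exp_nonneg _)
            (hexp.mul_const _) (Filter.Eventually.of_forall hstep)
      _ = (∫ z, Real.exp (t * h z) ∂P) * Real.exp (t ^ 2 * (m * c ^ 2) / 8) :=
          integral_mul_const _ _
      _ ≤ Real.exp (t * ∫ z, h z ∂P + t ^ 2 * c ^ 2 / 8) * Real.exp (t ^ 2 * (m * c ^ 2) / 8) :=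
          mul_le_mul_of_nonneg_right (integral_exp_mul_le P hhm hhc t) (Real.exp_nonneg _)
      _ = _ := by
          rw [← Real.exp_add]
          push_cast
          ring_nf

/-- McDiarmid's inequality: a one-sided confidence bound at level `1 - δ`. -/
theorem measure_gt_le_of_bounded_differences (P : Measure Z) [IsProbabilityMeasure P]
    {c K δ : ℝ} {m : ℕ} (hm : 1 ≤ m) (hc : 0 < c) (hδ : δ ∈ Set.Ioo (0 : ℝ) 1)
    {F : (Fin m → Z) → ℝ} (hF : Measurable F) (hK : ∀ S, |F S| ≤ K)
    (hd : ∀ S j z, F (Function.update S j z) - F S ≤ c) :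
    (Measure.pi fun _ => P) {S | (∫ S, F S ∂(Measure.pi fun _ => P)) +
      c * Real.sqrt (m * Real.log (1 / δ) / 2) < F S} ≤ ENNReal.ofReal δ := by
  set μ : Measure (Fin m → Z) := Measure.pi fun _ => P with hμ
  set s := Real.sqrt (m * Real.log (1 / δ) / 2) with hs
  have hm0 : (0 : ℝ) < m := by exact_mod_cast hm
  have hlog : 0 < Real.log (1 / δ) := Real.log_pos (by
    rw [lt_div_iff₀ hδ.1]; linarith [hδ.2])
  have hs0 : 0 ≤ s := Real.sqrt_nonneg _
  have hs2 : s ^ 2 = m * Real.log (1 / δ) / 2 := Real.sq_sqrt (by positivity)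
  -- This `t` minimizes the Chernoff exponent `-t c s + t² m c² / 8`; the minimum `-2 s² / m` equals
  -- `-log (1/δ)` by the choice of `s`.
  set t := 4 * s / (m * c) with ht
  have ht0 : 0 ≤ t := by positivity
  set E := ∫ S, F S ∂μ with hE
  have hint : Integrable (fun S => Real.exp (t * F S)) μ := by
    refine integrable_of_measurable_of_abs_le (K := Real.exp (t * K)) (hF.const_mul t).exp ?_
    intro S
    rw [abs_of_nonneg (Real.exp_nonneg _)]
    exact Real.exp_le_exp.2 (mul_le_mul_of_nonneg_left ((le_abs_self _).trans (hK S)) ht0)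
  have hch := ProbabilityTheory.measure_ge_le_exp_mul_mgf (μ := μ) (X := F) (E + c * s) ht0 hint
  have hmgf : ProbabilityTheory.mgf F μ t ≤ Real.exp (t * E + t ^ 2 * (m * c ^ 2) / 8) :=
    integral_exp_mul_pi_le P hF hK hd
  have hfin : μ.real {S | E + c * s ≤ F S} ≤ δ := by
    refine hch.trans ((mul_le_mul_of_nonneg_left hmgf (Real.exp_nonneg _)).trans (le_of_eq ?_))
    rw [← Real.exp_add]
    have : -t * (E + c * s) + (t * E + t ^ 2 * (m * c ^ 2) / 8) = -Real.log (1 / δ) := by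
      have h1 : -t * (E + c * s) + (t * E + t ^ 2 * (m * c ^ 2) / 8) = -(2 * s ^ 2 / m) := by
        rw [ht]; field_simp; ring
      rw [h1, hs2]; field_simp
    rw [this, one_div, Real.log_inv, neg_neg, Real.exp_log hδ.1]
  calc μ {S | E + c * s < F S} ≤ μ {S | E + c * s ≤ F S} :=
        measure_mono (ofPred_subset_ofPred.2 fun S hS => hS.le)
    _ = ENNReal.ofReal (μ.real {S | E + c * s ≤ F S}) := by simp [Measure.real]
    _ ≤ ENNReal.ofReal δ := ENNReal.ofReal_le_ofReal hfin

end Statistics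

/-! ### Symmetrization, contraction and the uniform bound for linear classes. -/

theorem bddAbove_range_of_abs_le {ι : Type*} {a : ι → ℝ} {K : ℝ} (h : ∀ i, |a i| ≤ K) :
    BddAbove (range a) :=
  ⟨K, by rintro _ ⟨i, rfl⟩; exact (le_abs_self _).trans (h i)⟩

theorem abs_ciSup_le {ι : Type*} [Nonempty ι] {a : ι → ℝ} {K : ℝ} (h : ∀ i, |a i| ≤ K) :
    |⨆ i, a i| ≤ K := by
  have i := Classical.arbitrary ι
  rw [abs_le]
  exact ⟨(abs_le.1 (h i)).1.trans (le_ciSup (bddAbove_range_of_abs_le h) i),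
    ciSup_le fun i => (abs_le.1 (h i)).2⟩

section Statistics

variable {Z : Type*} [MeasurableSpace Z] {E : Type*} [NormedAddCommGroup E] [InnerProductSpace ℝ E]

/-- Contraction: a sign can be moved from `g` to `f` if the differences of `g` are at most those
of `f`. -/
theorem ciSup_add_ciSup_sub_le {ι : Type*} [Nonempty ι] {a f g : ι → ℝ} {K : ℝ}
    (hp : ∀ i, |a i + f i| ≤ K) (hs : ∀ i, |a i - f i| ≤ K)
    (hfg : ∀ i j, |g i - g j| ≤ |f i - f j|) :
    (⨆ i, (a i + g i)) + (⨆ i, (a i - g i)) ≤ (⨆ i, (a i + f i)) + ⨆ i, (a i - f i) := by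
  -- `g i - g j` is at most `|f i - f j|`. According to the sign of `f i - f j`, bound with `i` in
  -- the supremum with `+f` and `j` in the one with `-f`, or the other way round.
  have key : ∀ i j, (a i + g i) + (a j - g j) ≤ (⨆ i, (a i + f i)) + ⨆ i, (a i - f i) := by
    intro i j
    have hi1 := le_ciSup (bddAbove_range_of_abs_le hp) i
    have hj1 := le_ciSup (bddAbove_range_of_abs_le hp) j
    have hi2 := le_ciSup (bddAbove_range_of_abs_le hs) i
    have hj2 := le_ciSup (bddAbove_range_of_abs_le hs) j
    have := (le_abs_self _).trans (hfg i j)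
    rcases abs_cases (f i - f j) with h | h <;> linarith
  have : (⨆ i, (a i + g i)) ≤
      (⨆ i, (a i + f i)) + (⨆ i, (a i - f i)) - ⨆ i, (a i - g i) := by
    refine ciSup_le fun i => ?_
    have : (⨆ j, (a j - g j)) ≤
        (⨆ i, (a i + f i)) + (⨆ i, (a i - f i)) - (a i + g i) :=
      ciSup_le fun j => by linarith [key i j]
    linarith
  linarith

/-- Symmetrization and contraction for one sample. -/
theorem integral_ciSup_sub_le (P : Measure Z) [IsProbabilityMeasure P] {a : ℕ → ℝ}
    {f g : ℕ → Z → ℝ} {K : ℝ} (ha : ∀ i, |a i| ≤ K) (hf : ∀ i z, |f i z| ≤ K)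
    (hg : ∀ i z, |g i z| ≤ K) (hfm : ∀ i, Measurable (f i)) (hgm : ∀ i, Measurable (g i))
    (hfg : ∀ i j z, 2 * |g i z - g j z| ≤ |f i z - f j z|) :
    ∫ z, ⨆ i, (a i + (∫ z, g i z ∂P) - g i z) ∂P ≤
      ∫ z, ((⨆ i, (a i + f i z)) + ⨆ i, (a i - f i z)) / 2 ∂P := by
  have hgp : ∀ i z, |a i + 2 * g i z| ≤ 3 * K := fun i z => by
    have h1 := abs_le.1 (ha i); have h2 := abs_le.1 (hg i z)
    exact abs_le.2 ⟨by linarith, by linarith⟩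
  have hgs : ∀ i z, |a i - 2 * g i z| ≤ 3 * K := fun i z => by
    have h1 := abs_le.1 (ha i); have h2 := abs_le.1 (hg i z)
    exact abs_le.2 ⟨by linarith, by linarith⟩
  have hfp : ∀ i z, |a i + f i z| ≤ 2 * K := fun i z => by
    have h1 := abs_le.1 (ha i); have h2 := abs_le.1 (hf i z)
    exact abs_le.2 ⟨by linarith, by linarith⟩
  have hfs : ∀ i z, |a i - f i z| ≤ 2 * K := fun i z => by
    have h1 := abs_le.1 (ha i); have h2 := abs_le.1 (hf i z)
    exact abs_le.2 ⟨by linarith, by linarith⟩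
  have hμ : ∀ i, |∫ z, g i z ∂P| ≤ K := fun i => by
    simpa using norm_integral_le_of_norm_le_const (μ := P) (f := g i) (C := K)
      (Filter.Eventually.of_forall fun z => hg i z)
  set sp : Z → ℝ := fun z => ⨆ i, (a i + 2 * g i z) with hsp
  set sm : Z → ℝ := fun z => ⨆ i, (a i - 2 * g i z) with hsm
  have hspm : Measurable sp := .iSup fun i => ((hgm i).const_mul 2).const_add _
  have hsmm : Measurable sm := .iSup fun i => ((hgm i).const_mul 2).const_sub _
  have hspi : Integrable sp P :=
    integrable_of_measurable_of_abs_le hspm fun z => abs_ciSup_le fun i => hgp i z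
  have hsmi : Integrable sm P :=
    integrable_of_measurable_of_abs_le hsmm fun z => abs_ciSup_le fun i => hgs i z
  -- Symmetrization without a ghost sample: the argument is the average of `a i + 2 ∫ g i` and `a i
  -- - 2 g i z`. The supremum is subadditive, and the supremum of means is at most the mean of
  -- suprema. This split is the source of the factor `2` in `hfg`.
  have hle : ∀ z, ⨆ i, (a i + (∫ z, g i z ∂P) - g i z) ≤ (∫ z, sp z ∂P) / 2 + sm z / 2 := by
    intro z
    refine ciSup_le fun i => ?_
    have h1 : a i + 2 * ∫ z, g i z ∂P ≤ ∫ z, sp z ∂P := by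
      have hi : Integrable (g i) P := integrable_of_measurable_of_abs_le (hgm i) (hg i)
      have : ∫ z, (a i + 2 * g i z) ∂P = a i + 2 * ∫ z, g i z ∂P := by
        rw [integral_add (integrable_const _) (hi.const_mul 2), integral_const_mul]; simp
      rw [← this]
      exact integral_mono ((integrable_const _).add (hi.const_mul 2)) hspi fun z =>
        le_ciSup (bddAbove_range_of_abs_le fun i => hgp i z) i
    have h2 : a i - 2 * g i z ≤ sm z := le_ciSup (bddAbove_range_of_abs_le fun i => hgs i z) i
    linarith
  have hLm : Measurable fun z => ⨆ i, (a i + (∫ z, g i z ∂P) - g i z) :=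
    .iSup fun i => (hgm i).const_sub _
  have hL : Integrable (fun z => ⨆ i, (a i + (∫ z, g i z ∂P) - g i z)) P := by
    refine integrable_of_measurable_of_abs_le (K := 3 * K) hLm fun z => abs_ciSup_le fun i => ?_
    have h1 := abs_le.1 (ha i); have h2 := abs_le.1 (hg i z); have h3 := abs_le.1 (hμ i)
    exact abs_le.2 ⟨by linarith, by linarith⟩
  have hR : Integrable (fun z => ((⨆ i, (a i + f i z)) + ⨆ i, (a i - f i z)) / 2) P := by
    refine (Integrable.add ?_ ?_).div_const 2
    · exact integrable_of_measurable_of_abs_le (.iSup fun i => (hfm i).const_add _)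
        fun z => abs_ciSup_le fun i => hfp i z
    · exact integrable_of_measurable_of_abs_le (.iSup fun i => (hfm i).const_sub _)
        fun z => abs_ciSup_le fun i => hfs i z
  calc _ ≤ ∫ z, ((∫ z, sp z ∂P) / 2 + sm z / 2) ∂P :=
        integral_mono hL ((integrable_const _).add (hsmi.div_const 2)) hle
    _ = ∫ z, (sp z + sm z) / 2 ∂P := by
        rw [integral_add (integrable_const _) (hsmi.div_const 2), integral_div, integral_div,
          integral_div, integral_add hspi hsmi, integral_const, probReal_univ, one_smul]
        ring
    _ ≤ _ := by
        refine integral_mono ((hspi.add hsmi).div_const 2) hR fun z => ?_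
        have := ciSup_add_ciSup_sub_le (a := a) (f := fun i => f i z) (g := fun i => 2 * g i z)
          (fun i => hfp i z) (fun i => hfs i z) (fun i j => by
            rw [← mul_sub, abs_mul, abs_two]; exact hfg i j z)
        simp only
        linarith

/-- The parallelogram law together with `(α + β)² ≤ 2 (α² + β²)`. It makes `v ↦ √(‖v‖² + q)` a
potential: averaging over the sign of a new term `u` costs only `‖u‖²` under the root, which closes
the induction of `integral_offsetGap_le`. -/
theorem sqrt_norm_add_sq_add_sqrt_norm_sub_sq_le (u v : E) {q : ℝ} (hq : 0 ≤ q) :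
    Real.sqrt (‖v + u‖ ^ 2 + q) + Real.sqrt (‖v - u‖ ^ 2 + q) ≤
      2 * Real.sqrt (‖v‖ ^ 2 + ‖u‖ ^ 2 + q) := by
  have hpar := parallelogram_law_with_norm ℝ v u
  have h1 := Real.sq_sqrt (show 0 ≤ ‖v + u‖ ^ 2 + q by positivity)
  have h2 := Real.sq_sqrt (show 0 ≤ ‖v - u‖ ^ 2 + q by positivity)
  have h3 := Real.sq_sqrt (show 0 ≤ ‖v‖ ^ 2 + ‖u‖ ^ 2 + q by positivity)
  refine abs_le_of_sq_le_sq' ?_ (by positivity) |>.2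
  nlinarith [sq_nonneg (Real.sqrt (‖v + u‖ ^ 2 + q) - Real.sqrt (‖v - u‖ ^ 2 + q))]

/-- The supremum, over the hypotheses `i`, of a linear offset plus the sum of the deviations of the
loss `g i` from its mean. -/
def offsetGap (P : Measure Z) (w : ℕ → E) (g : ℕ → Z → ℝ) {m : ℕ} (v : E) (S : Fin m → Z) : ℝ :=
  ⨆ i, (inner ℝ (w i) v + ∑ j, ((∫ z, g i z ∂P) - g i (S j)))

variable {P : Measure Z} {w : ℕ → E} {g : ℕ → Z → ℝ} {c : ℝ}

theorem abs_integral_sub_le [IsProbabilityMeasure P] (hg : ∀ i z, g i z ∈ Set.Icc 0 c) (i : ℕ)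
    (z : Z) :
    |(∫ z, g i z ∂P) - g i z| ≤ c := by
  have h1 : 0 ≤ ∫ z, g i z ∂P := integral_nonneg fun z => (hg i z).1
  have h2 : ∫ z, g i z ∂P ≤ c := by
    have := norm_integral_le_of_norm_le_const (μ := P) (f := g i) (C := c)
      (Filter.Eventually.of_forall fun z => by
        rw [Real.norm_eq_abs, abs_of_nonneg (hg i z).1]; exact (hg i z).2)
    simp only [probReal_univ, mul_one] at this
    exact (le_abs_self _).trans this
  exact abs_le.2 ⟨by linarith [(hg i z).2], by linarith [(hg i z).1]⟩

theorem abs_offset_le [IsProbabilityMeasure P] {B : ℝ} (hw : ∀ i, ‖w i‖ ≤ B)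
    (hg : ∀ i z, g i z ∈ Set.Icc 0 c) {m : ℕ}
    (v : E) (S : Fin m → Z) (i : ℕ) :
    |inner ℝ (w i) v + ∑ j, ((∫ z, g i z ∂P) - g i (S j))| ≤ B * ‖v‖ + m * c := by
  refine (abs_add_le _ _).trans (add_le_add ?_ ?_)
  · exact (abs_real_inner_le_norm _ _).trans
      (mul_le_mul_of_nonneg_right (hw i) (norm_nonneg _))
  · refine (Finset.abs_sum_le_sum_abs _ _).trans ?_
    refine (Finset.sum_le_sum fun j _ => abs_integral_sub_le hg i (S j)).trans ?_
    simp

theorem abs_offsetGap_le [IsProbabilityMeasure P] {B : ℝ} (hw : ∀ i, ‖w i‖ ≤ B)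
    (hg : ∀ i z, g i z ∈ Set.Icc 0 c) {m : ℕ}
    (v : E) (S : Fin m → Z) : |offsetGap P w g v S| ≤ B * ‖v‖ + m * c :=
  abs_ciSup_le fun i => abs_offset_le hw hg v S i

theorem measurable_offsetGap (hgm : ∀ i, Measurable (g i)) {m : ℕ} {α : Type*} [MeasurableSpace α]
    {v : α → E} (hv : ∀ i, Measurable fun z => inner ℝ (w i) (v z)) {S : α → Fin m → Z}
    (hS : Measurable S) :
    Measurable fun z => offsetGap P w g (v z) (S z) :=
  .iSup fun i => (hv i).add (Finset.measurable_fun_sum _ fun j _ =>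
    ((hgm i).comp ((measurable_pi_apply j).comp hS)).const_sub _)

/-- The Rademacher-type bound for the expected largest deviation over a bounded class of linear
hypotheses, composed with a Lipschitz loss. -/
theorem integral_offsetGap_le [IsProbabilityMeasure P] {B R L : ℝ} (hL : 0 ≤ L)
    (hw : ∀ i, ‖w i‖ ≤ B) (hg : ∀ i z, g i z ∈ Set.Icc 0 c) (hgm : ∀ i, Measurable (g i))
    {φ : Z → E} (hφ : ∀ z, ‖φ z‖ ≤ R) (hφm : ∀ i, Measurable fun z => inner ℝ (w i) (φ z))
    (hlip : ∀ i j z, |g i z - g j z| ≤ L * |inner ℝ (w i) (φ z) - inner ℝ (w j) (φ z)|)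
    (m : ℕ) (v : E) :
    ∫ S, offsetGap P w g v S ∂(Measure.pi fun _ : Fin m => P) ≤
      B * Real.sqrt (‖v‖ ^ 2 + m * (2 * L * R) ^ 2) := by
  have hB : 0 ≤ B := (norm_nonneg _).trans (hw 0)
  have hc : 0 ≤ c := by
    obtain ⟨z₀⟩ : Nonempty Z := by
      by_contra hne
      rw [not_nonempty_iff] at hne
      exact IsProbabilityMeasure.ne_zero P (Measure.eq_zero_of_isEmpty P)
    exact (hg 0 z₀).1.trans (hg 0 z₀).2
  -- The offset must be general: the induction hypothesis is used at `v + u z` and at `v - u z`.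
  induction m generalizing v with
  | zero =>
    have h1 : ∀ S : Fin 0 → Z, offsetGap P w g v S ≤ B * ‖v‖ := fun S => by
      simpa using (abs_le.1 (abs_offsetGap_le hw hg v S)).2
    have h2 : B * Real.sqrt (‖v‖ ^ 2 + (0 : ℕ) * (2 * L * R) ^ 2) = B * ‖v‖ := by
      simp
    rw [h2]
    calc _ ≤ ∫ _ : Fin 0 → Z, B * ‖v‖ ∂(Measure.pi fun _ => P) :=
          integral_mono (integrable_of_measurable_of_abs_le
            (measurable_offsetGap hgm (fun i => measurable_const) measurable_id)
            fun S => abs_offsetGap_le hw hg v S) (integrable_const _) h1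
      _ = B * ‖v‖ := by simp
  | succ m ih =>
    -- The factor `L` pays for the contraction and the factor `2` for the symmetrization.
    set u : Z → E := fun z => (2 * L) • φ z with hu
    have hun : ∀ z, ‖u z‖ ≤ 2 * L * R := fun z => by
      rw [hu, norm_smul, Real.norm_of_nonneg (by positivity)]
      exact mul_le_mul_of_nonneg_left (hφ z) (by positivity)
    have hum : ∀ i, Measurable fun z => inner ℝ (w i) (u z) := fun i => by
      simp only [hu, inner_smul_right]
      exact (hφm i).const_mul _
    have hup : ∀ i, Measurable fun p : Z × (Fin m → Z) => inner ℝ (w i) (v + u p.1) := fun i => by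
      simp only [inner_add_right]
      exact ((hum i).comp measurable_fst).const_add _
    have hus : ∀ i, Measurable fun p : Z × (Fin m → Z) => inner ℝ (w i) (v - u p.1) := fun i => by
      simp only [inner_sub_right]
      exact ((hum i).comp measurable_fst).const_sub _
    -- The gap of the remaining samples, averaged over the two signs with which the first sample
    -- enters the offset.
    set s : Z × (Fin m → Z) → ℝ := fun p =>
      (offsetGap P w g (v + u p.1) p.2 + offsetGap P w g (v - u p.1) p.2) / 2 with hs
    have hsm : Measurable s :=
      ((measurable_offsetGap hgm hup measurable_snd).add
        (measurable_offsetGap hgm hus measurable_snd)).div_const 2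
    have hip : ∀ z, Integrable (fun S : Fin m → Z => offsetGap P w g (v + u z) S)
        (Measure.pi fun _ => P) := fun z =>
      integrable_of_measurable_of_abs_le
        (measurable_offsetGap hgm (fun _ => measurable_const) measurable_id)
        fun S => abs_offsetGap_le hw hg _ S
    have his : ∀ z, Integrable (fun S : Fin m → Z => offsetGap P w g (v - u z) S)
        (Measure.pi fun _ => P) := fun z =>
      integrable_of_measurable_of_abs_le
        (measurable_offsetGap hgm (fun _ => measurable_const) measurable_id)
        fun S => abs_offsetGap_le hw hg _ S
    have hsb : ∀ p, |s p| ≤ B * (‖v‖ + 2 * L * R) + m * c := by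
      intro p
      have h1 := abs_le.1 (abs_offsetGap_le (P := P) hw hg (v + u p.1) p.2)
      have h2 := abs_le.1 (abs_offsetGap_le (P := P) hw hg (v - u p.1) p.2)
      have h3 : B * ‖v + u p.1‖ ≤ B * (‖v‖ + 2 * L * R) :=
        mul_le_mul_of_nonneg_left ((norm_add_le _ _).trans (by linarith [hun p.1])) hB
      have h4 : B * ‖v - u p.1‖ ≤ B * (‖v‖ + 2 * L * R) :=
        mul_le_mul_of_nonneg_left ((norm_sub_le _ _).trans (by linarith [hun p.1])) hB
      exact abs_le.2 ⟨by simp only [hs]; linarith, by simp only [hs]; linarith⟩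
    have hsi : Integrable s (P.prod (Measure.pi fun _ : Fin m => P)) :=
      integrable_of_measurable_of_abs_le hsm hsb
    have hGi : Integrable (fun p : Z × (Fin m → Z) =>
        offsetGap P w g v (Fin.cons p.1 p.2 : Fin (m + 1) → Z))
        (P.prod (Measure.pi fun _ : Fin m => P)) :=
      integrable_of_measurable_of_abs_le
        (measurable_offsetGap hgm (fun _ => measurable_const) measurable_finCons)
        fun p => abs_offsetGap_le hw hg v _
    have hone : ∀ S : Fin m → Z,
        ∫ z, offsetGap P w g v (Fin.cons z S : Fin (m + 1) → Z) ∂P ≤ ∫ z, s (z, S) ∂P := by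
      intro S
      set K := max (B * ‖v‖ + m * c) (max (B * (2 * L * R)) c) with hK
      have := integral_ciSup_sub_le P (K := K)
        (a := fun i => inner ℝ (w i) v + ∑ j, ((∫ z, g i z ∂P) - g i (S j)))
        (f := fun i z => inner ℝ (w i) (u z)) (g := g)
        (fun i => (abs_offset_le hw hg v S i).trans (le_max_left _ _))
        (fun i z => ((abs_real_inner_le_norm _ _).trans
          (mul_le_mul (hw i) (hun z) (norm_nonneg _) hB)).trans
          ((le_max_left _ _).trans (le_max_right _ _)))
        (fun i z => by
          rw [abs_of_nonneg (hg i z).1]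
          exact (hg i z).2.trans ((le_max_right _ _).trans (le_max_right _ _)))
        hum hgm (fun i j z => by
          simp only [hu, inner_smul_right]
          rw [← mul_sub, abs_mul, abs_of_nonneg (by positivity : 0 ≤ 2 * L), mul_assoc]
          exact mul_le_mul_of_nonneg_left (hlip i j z) zero_le_two)
      refine (le_of_eq ?_).trans (this.trans (le_of_eq ?_))
      · refine integral_congr_ae (Filter.Eventually.of_forall fun z => ?_)
        simp only [offsetGap, Fin.sum_univ_succ, Fin.cons_zero, Fin.cons_succ]
        congr 1; funext i; ring
      · refine integral_congr_ae (Filter.Eventually.of_forall fun z => ?_)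
        simp only [hs, offsetGap, inner_add_right, inner_sub_right]
        congr 3
        · funext i; ring
        · funext i; ring
    have hz : ∀ z, ∫ S, s (z, S) ∂(Measure.pi fun _ : Fin m => P) ≤
        B * Real.sqrt (‖v‖ ^ 2 + (m + 1 : ℕ) * (2 * L * R) ^ 2) := by
      intro z
      have h1 : ∫ S, s (z, S) ∂(Measure.pi fun _ : Fin m => P) =
          ((∫ S, offsetGap P w g (v + u z) S ∂(Measure.pi fun _ : Fin m => P)) +
            ∫ S, offsetGap P w g (v - u z) S ∂(Measure.pi fun _ : Fin m => P)) / 2 := by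
        rw [← integral_add (hip z) (his z), ← integral_div]
      have h2 := sqrt_norm_add_sq_add_sqrt_norm_sub_sq_le (u z) v
        (show 0 ≤ (m : ℝ) * (2 * L * R) ^ 2 by positivity)
      have h3 : Real.sqrt (‖v‖ ^ 2 + ‖u z‖ ^ 2 + m * (2 * L * R) ^ 2) ≤
          Real.sqrt (‖v‖ ^ 2 + (m + 1 : ℕ) * (2 * L * R) ^ 2) := by
        refine Real.sqrt_le_sqrt ?_
        have := pow_le_pow_left₀ (norm_nonneg _) (hun z) 2
        push_cast
        linarith
      have h4 := mul_le_mul_of_nonneg_left (h2.trans (mul_le_mul_of_nonneg_left h3 zero_le_two)) hB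
      rw [h1]
      linarith [ih (v + u z), ih (v - u z)]
    -- The first sample is integrated innermost, so that `hone` can exchange it with the others
    -- frozen. Afterwards the order is reversed, so that the induction hypothesis applies for each
    -- fixed `z`.
    rw [integral_pi_cons, integral_prod_symm _ hGi]
    calc _ ≤ ∫ S, ∫ z, s (z, S) ∂P ∂(Measure.pi fun _ : Fin m => P) :=
          integral_mono hGi.integral_prod_right hsi.integral_prod_right hone
      _ = ∫ z, ∫ S, s (z, S) ∂(Measure.pi fun _ : Fin m => P) ∂P := by
          rw [← integral_prod_symm _ hsi, integral_prod _ hsi]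
      _ ≤ ∫ _, B * Real.sqrt (‖v‖ ^ 2 + (m + 1 : ℕ) * (2 * L * R) ^ 2) ∂P :=
          integral_mono hsi.integral_prod_left (integrable_const _) hz
      _ = _ := by simp


theorem offsetGap_update_sub_le [IsProbabilityMeasure P] {B : ℝ} (hw : ∀ i, ‖w i‖ ≤ B)
    (hg : ∀ i z, g i z ∈ Set.Icc 0 c) {m : ℕ} (v : E) (S : Fin m → Z) (j : Fin m) (z : Z) :
    offsetGap P w g v (Function.update S j z) - offsetGap P w g v S ≤ c := by
  rw [sub_le_iff_le_add]
  refine ciSup_le fun i => ?_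
  have h1 : inner ℝ (w i) v + ∑ k, ((∫ z, g i z ∂P) - g i (S k)) ≤ offsetGap P w g v S :=
    le_ciSup (bddAbove_range_of_abs_le fun i => abs_offset_le hw hg v S i) i
  have h2 : ∑ k, ((∫ z, g i z ∂P) - g i (Function.update S j z k)) -
      ∑ k, ((∫ z, g i z ∂P) - g i (S k)) = g i (S j) - g i z := by
    rw [← Finset.sum_sub_distrib, Finset.sum_eq_single j]
    · simp
    · intro k _ hk
      simp [hk]
    · simp
  linarith [(hg i (S j)).2, (hg i z).1]

/-- Uniform generalization bound for a Lipschitz loss and a class of hypotheses that are linear in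
a bounded feature map, with bounded weights. -/
theorem gapBound_of_linear [TopologicalSpace.SeparableSpace E] {d m : ℕ} (hm : 1 ≤ m) {c : ℝ}
    {L : NNReal} {l : ℝ → ℝ → ℝ} (hlm : Measurable fun p : ℝ × ℝ => l p.1 p.2)
    (hl : ∀ y z, l y z ∈ Set.Icc 0 c) (hlip : ∀ y, LipschitzWith L (l y))
    (P : Measure (Inputs d × ℝ)) [IsProbabilityMeasure P] {δ : ℝ} (hδ : δ ∈ Set.Ioo (0 : ℝ) 1)
    {B R : ℝ} (hB : 0 ≤ B) (hR : 0 ≤ R) {φ : Inputs d → E} (hφ : ∀ x, ‖φ x‖ ≤ R)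
    (hφm : ∀ v, Measurable fun x => inner ℝ v (φ x)) {F : Set (Inputs d → ℝ)}
    (hF : ∀ f ∈ F, ∃ v : E, ‖v‖ ≤ B ∧ ∀ x, f x = inner ℝ v (φ x)) :
    GapBound F l P m δ (2 * (L * B / Real.sqrt m * R + c * Real.sqrt (Real.log (1 / δ) / m))) := by
  have hc : 0 ≤ c := (hl 0 0).1.trans (hl 0 0).2
  have hlog : 0 < Real.log (1 / δ) := Real.log_pos (by
    rw [lt_div_iff₀ hδ.1]; linarith [hδ.2])
  have hm0 : (0 : ℝ) < m := by exact_mod_cast hm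
  set ε := 2 * (L * B / Real.sqrt m * R + c * Real.sqrt (Real.log (1 / δ) / m)) with hε
  have hε0 : 0 ≤ ε := by positivity
  -- For `c = 0` the loss vanishes; the choice of the Chernoff parameter in McDiarmid's inequality
  -- divides by `c`.
  rcases hc.eq_or_lt with hc0 | hcpos
  · have hl0 : ∀ y z, l y z = 0 := fun y z => le_antisymm (hc0 ▸ (hl y z).2) (hl y z).1
    have : {S : Fin m → Inputs d × ℝ | ∀ f ∈ F, risk l P f - empRisk l S f ≤ ε} = univ := by
      refine eq_univ_of_forall fun S f _ => ?_
      simpa [risk, empRisk, hl0] using hε0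
    rw [GapBound, this, measure_univ]
    exact ENNReal.ofReal_le_one.2 (by linarith [hδ.1])
  have : Nonempty (Metric.closedBall (0 : E) B) := ⟨⟨0, by simpa using hB⟩⟩
  -- A dense sequence of weights makes the supremum countable, hence measurable. The event of
  -- `GapBound` need not be measurable; it only has to contain the complement of the measurable set
  -- `bad`.
  set w : ℕ → Metric.closedBall (0 : E) B := TopologicalSpace.denseSeq _ with hw_def
  have hw : ∀ i, ‖(w i : E)‖ ≤ B := fun i => mem_closedBall_zero_iff.1 (w i).2
  set g : E → Inputs d × ℝ → ℝ := fun v z => l z.2 (inner ℝ v (φ z.1)) with hg_def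
  have hg : ∀ v z, g v z ∈ Set.Icc 0 c := fun v z => hl _ _
  have hgm : ∀ v, Measurable (g v) := fun v =>
    hlm.comp (measurable_snd.prodMk ((hφm v).comp measurable_fst))
  have hgc : ∀ z, Continuous fun v => g v z := fun z =>
    (hlip _).continuous.comp (continuous_id.inner continuous_const)
  set G : (Fin m → Inputs d × ℝ) → ℝ :=
    offsetGap P (fun i => (w i : E)) (fun i => g (w i)) 0 with hG
  have hGm : Measurable G :=
    measurable_offsetGap (fun i => hgm _) (fun _ => measurable_const) measurable_id
  have hmean : ∫ S, G S ∂(Measure.pi fun _ => P) ≤ B * Real.sqrt (m * (2 * L * R) ^ 2) := by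
    have := integral_offsetGap_le (P := P) (w := fun i => (w i : E)) (g := fun i => g (w i))
      (φ := fun z => φ z.1) L.2 hw (fun i => hg _) (fun i => hgm _) (fun z => hφ z.1)
      (fun i => (hφm _).comp measurable_fst) (fun i j z => by
        simpa [Real.dist_eq] using (hlip z.2).dist_le_mul (inner ℝ (w i : E) (φ z.1))
          (inner ℝ (w j : E) (φ z.1))) m 0
    simpa using this
  set bad : Set (Fin m → Inputs d × ℝ) := {S | (∫ S, G S ∂(Measure.pi fun _ => P)) +
      c * Real.sqrt (m * Real.log (1 / δ) / 2) < G S} with hbad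
  have hbm : MeasurableSet bad := measurableSet_lt measurable_const hGm
  have hbad_le : (Measure.pi fun _ => P) bad ≤ ENNReal.ofReal δ :=
    measure_gt_le_of_bounded_differences P hm hcpos hδ hGm
      (fun S => abs_offsetGap_le hw (fun i => hg _) 0 S)
      (fun S j z => offsetGap_update_sub_le hw (fun i => hg _) 0 S j z)
  have hgood : badᶜ ⊆ {S : Fin m → Inputs d × ℝ | ∀ f ∈ F, risk l P f - empRisk l S f ≤ ε} := by
    intro S hS f hf
    have hS' : G S ≤ (∫ S, G S ∂(Measure.pi fun _ => P)) +
      c * Real.sqrt (m * Real.log (1 / δ) / 2) := not_lt.1 hS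
    have hi : ∀ i, (∫ z, g (w i) z ∂P) - 1 / (m : ℝ) * ∑ j, g (w i) (S j) ≤ ε := by
      intro i
      have h1 : inner ℝ (w i : E) 0 + ∑ k, ((∫ z, g (w i) z ∂P) - g (w i) (S k)) ≤ G S :=
        le_ciSup (bddAbove_range_of_abs_le fun i =>
          abs_offset_le (P := P) (g := fun i => g (w i)) hw (fun i => hg _) 0 S i) i
      have h2 : Real.sqrt (m * (2 * L * R) ^ 2) = Real.sqrt m * (2 * L * R) := by
        rw [Real.sqrt_mul hm0.le, Real.sqrt_sq (by positivity)]
      have h3 : Real.sqrt (m * Real.log (1 / δ) / 2) ≤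
          m * Real.sqrt (Real.log (1 / δ) / m) := by
        rw [← Real.sqrt_sq hm0.le, ← Real.sqrt_mul (sq_nonneg _), Real.sqrt_sq hm0.le]
        refine Real.sqrt_le_sqrt ?_
        have : (m : ℝ) ^ 2 * (Real.log (1 / δ) / m) = m * Real.log (1 / δ) := by field_simp
        rw [this]
        have : 0 < m * Real.log (1 / δ) := by positivity
        linarith
      have h4 : ∑ k, ((∫ z, g (w i) z ∂P) - g (w i) (S k)) =
          m * ((∫ z, g (w i) z ∂P) - 1 / (m : ℝ) * ∑ j, g (w i) (S j)) := by
        rw [Finset.sum_sub_distrib, mul_sub, ← mul_assoc]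
        simp [hm0.ne']
      have h5 : (m : ℝ) * ε = 2 * (L * B * R * (m / Real.sqrt m)) +
          2 * (c * (m * Real.sqrt (Real.log (1 / δ) / m))) := by
        rw [hε]; ring
      rw [Real.div_sqrt] at h5
      rw [inner_zero_right, zero_add, h4] at h1
      rw [h2] at hmean
      have h6 := mul_le_mul_of_nonneg_left h3 hc
      have h7 : 0 ≤ c * (m * Real.sqrt (Real.log (1 / δ) / m)) := by positivity
      refine le_of_mul_le_mul_left ?_ hm0
      rw [h5]
      linarith
    obtain ⟨v, hv, hfv⟩ := hF f hf
    -- The gap is continuous in the weight, by dominated convergence, so the bound passes from the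
    -- dense sequence to the whole ball.
    have hcont : Continuous fun v : Metric.closedBall (0 : E) B =>
        (∫ z, g v z ∂P) - 1 / (m : ℝ) * ∑ j, g v (S j) := by
      refine Continuous.sub ?_ (continuous_const.mul (continuous_finsetSum _ fun j _ =>
        (hgc _).comp continuous_subtype_val))
      refine continuous_of_dominated (bound := fun _ => c)
        (fun v => (hgm _).aestronglyMeasurable) (fun v => Filter.Eventually.of_forall fun z => ?_)
        (integrable_const _)
        (Filter.Eventually.of_forall fun z => (hgc z).comp continuous_subtype_val)
      rw [Real.norm_eq_abs, abs_of_nonneg (hg _ z).1]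
      exact (hg _ z).2
    have hall := (TopologicalSpace.denseRange_denseSeq (Metric.closedBall (0 : E) B)).induction_on
      (p := fun v => (∫ z, g v z ∂P) - 1 / (m : ℝ) * ∑ j, g v (S j) ≤ ε)
      ⟨v, by simpa using hv⟩ (isClosed_le hcont continuous_const) hi
    simpa only [risk, empRisk, hfv, hg_def] using hall
  calc ENNReal.ofReal (1 - δ) = 1 - ENNReal.ofReal δ := by
        rw [ENNReal.ofReal_sub _ hδ.1.le, ENNReal.ofReal_one]
    _ ≤ 1 - (Measure.pi fun _ => P) bad := tsub_le_tsub_left hbad_le _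
    _ = (Measure.pi fun _ => P) badᶜ := (prob_compl_eq_one_sub hbm).symm
    _ ≤ _ := measure_mono hgood

end Statistics

/-! ### Eigenvalues and their differences for Pauli strings and local Hamiltonians. -/

section Spectra

variable {n : ℕ}

theorem exists_eigenvector {H : HermOp n} {r : ℝ} (hr : r ∈ spec H) :
    ∃ v : Bits n → ℂ, v ≠ 0 ∧ H.1.mulVec v = (r : ℂ) • v := by
  rw [spec, H.2.spectrum_real_eq_range_eigenvalues] at hr
  obtain ⟨j, rfl⟩ := hr
  refine ⟨(H.2.eigenvectorBasis j).ofLp, fun h => ?_, ?_⟩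
  · refine H.2.eigenvectorBasis.toBasis.ne_zero j ?_
    ext k
    simpa using congrFun h k
  · exact H.2.mulVec_eigenvectorBasis j

theorem spec_finite (H : HermOp n) : (spec H).Finite := by
  rw [spec, H.2.spectrum_real_eq_range_eigenvalues]
  exact Set.finite_range _

theorem diffs_eq_image (H : HermOp n) :
    diffs H = (fun p : ℝ × ℝ => p.1 - p.2) '' (spec H ×ˢ spec H) := by
  ext r
  constructor
  · rintro ⟨a, ha, b, hb, rfl⟩
    exact ⟨(a, b), ⟨ha, hb⟩, rfl⟩
  · rintro ⟨⟨a, b⟩, ⟨ha, hb⟩, rfl⟩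
    exact ⟨a, ha, b, hb, rfl⟩

theorem diffs_finite (H : HermOp n) : (diffs H).Finite := by
  rw [diffs_eq_image]
  exact ((spec_finite H).prod (spec_finite H)).image _

theorem ncard_diffs_le (H : HermOp n) : (diffs H).ncard ≤ (spec H).ncard ^ 2 := by
  rw [diffs_eq_image, pow_two, ← Set.ncard_prod]
  exact Set.ncard_image_le ((spec_finite H).prod (spec_finite H))

theorem neg_mem_diffs {H : HermOp n} {r : ℝ} (hr : r ∈ diffs H) : -r ∈ diffs H := by
  obtain ⟨a, ha, b, hb, rfl⟩ := hr
  exact ⟨b, hb, a, ha, by ring⟩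

theorem zero_mem_diffs (H : HermOp n) : 0 ∈ diffs H := by
  have : H.2.eigenvalues 0 ∈ spec H := H.2.eigenvalues_mem_spectrum_real 0
  exact ⟨_, this, _, this, by simp⟩

theorem pauli_mul_self (q : Fin 4) : pauli q * pauli q = 1 := by
  ext i j
  fin_cases q <;> fin_cases i <;> fin_cases j <;> simp [pauli, Matrix.mul_apply]

/-- Summing a product of one-qubit entries over all bit strings factors into one-qubit matrix
products, each of which is the square of a Pauli matrix. -/
theorem IsPauliString.mul_self {H : HermOp n} (h : IsPauliString H) : H.1 * H.1 = 1 := by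
  obtain ⟨p, hp⟩ := h
  ext a b
  rw [Matrix.mul_apply]
  calc ∑ c, H.1 a c * H.1 c b
      = ∑ c : Bits n, ∏ k, pauli (p k) (a k) (c k) * pauli (p k) (c k) (b k) := by
        refine Finset.sum_congr rfl fun c _ => ?_
        rw [hp, hp, Finset.prod_mul_distrib]
    _ = ∏ k, ∑ x, pauli (p k) (a k) x * pauli (p k) x (b k) := by
        rw [Finset.prod_univ_sum, Fintype.piFinset_univ]
    _ = ∏ k, (1 : Matrix (Fin 2) (Fin 2) ℂ) (a k) (b k) := by
        refine Finset.prod_congr rfl fun k _ => ?_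
        rw [← Matrix.mul_apply, pauli_mul_self]
    _ = (1 : Matrix (Bits n) (Bits n) ℂ) a b := by
        rw [Matrix.one_apply]
        split_ifs with hab
        · subst hab
          exact Finset.prod_eq_one fun k _ => Matrix.one_apply_eq _
        · obtain ⟨k, hk⟩ := Function.ne_iff.1 hab
          exact Finset.prod_eq_zero (Finset.mem_univ k) (Matrix.one_apply_ne hk)

theorem IsPauliString.spec_subset {H : HermOp n} (h : IsPauliString H) {r : ℝ} (hr : r ∈ spec H) :
    r = 1 ∨ r = -1 := by
  obtain ⟨v, hv, hHv⟩ := exists_eigenvector hr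
  have h1 : H.1.mulVec (H.1.mulVec v) = v := by
    rw [Matrix.mulVec_mulVec, h.mul_self, Matrix.one_mulVec]
  rw [hHv, Matrix.mulVec_smul, hHv, smul_smul] at h1
  obtain ⟨k, hk⟩ := Function.ne_iff.1 hv
  have h2 := congrFun h1 k
  simp only [Pi.smul_apply, smul_eq_mul] at h2
  have h3 : (r : ℂ) * r = 1 := mul_right_cancel₀ hk (by rw [h2, one_mul])
  exact mul_self_eq_one_iff.1 (by exact_mod_cast h3)

theorem IsPauliString.diffs_subset {H : HermOp n} (h : IsPauliString H) {r : ℝ}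
    (hr : r ∈ diffs H) : ∃ k : ℤ, |k| ≤ 1 ∧ r = k * 2 := by
  obtain ⟨a, ha, b, hb, rfl⟩ := hr
  rcases h.spec_subset ha with rfl | rfl <;> rcases h.spec_subset hb with rfl | rfl
  · exact ⟨0, by norm_num, by norm_num⟩
  · exact ⟨1, by norm_num, by norm_num⟩
  · exact ⟨-1, by norm_num, by norm_num⟩
  · exact ⟨0, by norm_num, by norm_num⟩

theorem IsPauliString.hasIntegerFrequencies {H : HermOp n} (h : IsPauliString H) :
    HasIntegerFrequencies H := by
  intro r hr
  obtain ⟨k, -, rfl⟩ := h.diffs_subset hr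
  exact ⟨k * 2, by push_cast; ring⟩

open Classical in
/-- An eigenvalue of `h ⊗ 1` is an eigenvalue of `h`. -/
theorem isRoot_charpoly_of_local {H : HermOp n} {s : Finset (Fin n)}
    {h : Matrix (s → Fin 2) (s → Fin 2) ℂ}
    (hH : ∀ a b : Bits n, H.1 a b =
      if ∀ k ∉ s, a k = b k then h (fun k => a k) (fun k => b k) else 0)
    {r : ℝ} (hr : r ∈ spec H) : h.charpoly.IsRoot (r : ℂ) := by
  obtain ⟨v, hv, hHv⟩ := exists_eigenvector hr
  obtain ⟨a, ha⟩ := Function.ne_iff.1 hv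
  -- Bits on `s` are free; the others are frozen to a string `a` at which the eigenvector `v` of `H`
  -- is nonzero. The slice of `v` along `glue` is then a nonzero eigenvector of `h`.
  set glue : (s → Fin 2) → Bits n := fun x k => if hk : k ∈ s then x ⟨k, hk⟩ else a k with hglue
  have hglue_in : ∀ x, (fun k : s => glue x k) = x := fun x => by
    funext k; simp [hglue]
  have hglue_out : ∀ x, ∀ k ∉ s, glue x k = a k := fun x k hk => by simp [hglue, hk]
  have hmul : h.mulVec (fun x => v (glue x)) = (r : ℂ) • fun x => v (glue x) := by
    funext x
    have h1 := congrFun hHv (glue x)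
    simp only [Pi.smul_apply] at h1 ⊢
    rw [← h1, Matrix.mulVec, Matrix.mulVec, dotProduct, dotProduct]
    refine Finset.sum_of_injOn glue (fun y _ y' _ hyy => ?_) (fun _ _ => Finset.mem_univ _)
      (fun b _ hb => ?_) fun y _ => ?_
    · rw [← hglue_in y, ← hglue_in y', hyy]
    · rw [hH, if_neg, zero_mul]
      intro hab
      refine hb ⟨fun k => b k, Finset.mem_coe.2 (Finset.mem_univ _), ?_⟩
      funext k
      by_cases hk : k ∈ s
      · simp [hglue, hk]
      · exact (hglue_out (fun k : s => b k) k hk).trans ((hglue_out x k hk).symm.trans (hab k hk))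
    · rw [hH, if_pos fun k hk => by rw [hglue_out _ k hk, hglue_out _ k hk], hglue_in, hglue_in]
  rw [Polynomial.IsRoot, Matrix.eval_charpoly, ← Matrix.exists_mulVec_eq_zero_iff]
  refine ⟨fun x => v (glue x), Function.ne_iff.2 ⟨fun k => a k, ?_⟩, ?_⟩
  · have : glue (fun k => a k) = a := by
      funext k
      by_cases hk : k ∈ s <;> simp [hglue, hk]
    rw [this]
    exact ha
  · rw [Matrix.sub_mulVec, hmul, Matrix.scalar_apply, ← Matrix.smul_one_eq_diagonal,
      Matrix.smul_mulVec, Matrix.one_mulVec, sub_self]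

/-- The spectrum embeds into the roots of the characteristic polynomial of the local factor, whose
degree is `2 ^ s.card`, independently of `n`. -/
theorem IsLocal.ncard_spec_le {κ : ℕ} {H : HermOp n} (hH : IsLocal κ H) :
    (spec H).ncard ≤ 2 ^ κ := by
  classical
  obtain ⟨s, hs, h, hh⟩ := hH
  have hsub : Complex.ofReal '' spec H ⊆ (h.charpoly.roots.toFinset : Set ℂ) := by
    rintro _ ⟨r, hr, rfl⟩
    simp only [Finset.mem_coe, Multiset.mem_toFinset]
    refine (Polynomial.mem_roots (Matrix.charpoly_monic h).ne_zero).2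
      (isRoot_charpoly_of_local (fun a b => ?_) hr)
    convert hh a b
  calc (spec H).ncard = (Complex.ofReal '' spec H).ncard :=
        (Set.ncard_image_of_injective _ Complex.ofReal_injective).symm
    _ ≤ h.charpoly.roots.toFinset.card := by
        rw [← Set.ncard_coe_finset]
        exact Set.ncard_le_ncard hsub (Finset.finite_toSet _)
    _ ≤ h.charpoly.natDegree :=
        (Multiset.toFinset_card_le _).trans (Polynomial.card_roots' _)
    _ = 2 ^ s.card := by simp [Matrix.charpoly_natDegree_eq_dim]
    _ ≤ 2 ^ κ := Nat.pow_le_pow_right (by norm_num) hs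

end Spectra

/-! ### Cardinality of the frequency set. -/

section Counting

variable {n d : ℕ}

theorem ncard_add_le {α : Type*} [Add α] {s t : Set α} (hs : s.Finite) (ht : t.Finite) :
    (s + t).ncard ≤ s.ncard * t.ncard := by
  rw [← Set.ncard_prod, ← Set.add_image_prod]
  exact Set.ncard_image_le (hs.prod ht)

theorem gateFrequencies_finite (i : Fin d) (H : HermOp n) : (gateFrequencies i H).Finite :=
  (diffs_finite H).image _

theorem sum_gateFrequencies_finite (i : Fin d) (s : Multiset (HermOp n)) :
    ((s.map (gateFrequencies i)).sum).Finite := by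
  induction s using Multiset.induction_on with
  | empty => simp
  | cons H s ih =>
    rw [Multiset.map_cons, Multiset.sum_cons]
    exact (gateFrequencies_finite i H).add ih

theorem ncard_sum_le_prod {ι α : Type*} [AddCommMonoid α] (A : ι → Set α)
    (hA : ∀ i, (A i).Finite) (s : Finset ι) :
    (∑ i ∈ s, A i).Finite ∧ (∑ i ∈ s, A i).ncard ≤ ∏ i ∈ s, (A i).ncard := by
  classical
  induction s using Finset.induction_on with
  | empty => simp [← Set.singleton_zero]
  | insert i s hi ih =>
    rw [Finset.sum_insert hi, Finset.prod_insert hi]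
    exact ⟨(hA i).add ih.1, (ncard_add_le (hA i) ih.1).trans (Nat.mul_le_mul_left _ ih.2)⟩

theorem Encoding.ncard_frequencies_le_prod (D : Encoding n d) :
    D.frequencies.ncard ≤ ∏ i, (((D i).map (gateFrequencies i)).sum).ncard :=
  (ncard_sum_le_prod _ (fun i => sum_gateFrequencies_finite i (D i)) Finset.univ).2

theorem ncard_sum_gateFrequencies_le_pow {K : ℕ} (i : Fin d) (s : Multiset (HermOp n))
    (hs : ∀ H ∈ s, (diffs H).ncard ≤ K) :
    ((s.map (gateFrequencies i)).sum).ncard ≤ K ^ Multiset.card s := by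
  induction s using Multiset.induction_on with
  | empty => simp [← Set.singleton_zero]
  | cons H s ih =>
    rw [Multiset.map_cons, Multiset.sum_cons, Multiset.card_cons, pow_succ']
    refine (ncard_add_le (gateFrequencies_finite i H) (sum_gateFrequencies_finite i s)).trans
      (Nat.mul_le_mul ?_ (ih fun H' hH' => hs H' (Multiset.mem_cons_of_mem hH')))
    exact (Set.ncard_image_le (diffs_finite H)).trans (hs H (Multiset.mem_cons_self H s))

theorem Encoding.ncard_frequencies_le_pow {K : ℕ} (D : Encoding n d)
    (hD : ∀ i, ∀ H ∈ D i, (diffs H).ncard ≤ K) : D.frequencies.ncard ≤ K ^ D.numGates := by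
  rw [Encoding.numGates, ← Finset.prod_pow_eq_pow_sum]
  exact D.ncard_frequencies_le_prod.trans
    (Finset.prod_le_prod' fun i _ => ncard_sum_gateFrequencies_le_pow i (D i) (hD i))

/-- If all eigenvalue differences are combinations of the numbers `v j` with coefficients in
`{-1, 0, 1}`, then the frequencies are combinations with coefficients bounded by the number of
gates. -/
theorem sum_gateFrequencies_subset {J : Type*} [Fintype J] (v : J → ℝ) (i : Fin d)
    (s : Multiset (HermOp n))
    (hs : ∀ H ∈ s, ∀ r ∈ diffs H, ∃ k : J → ℤ, (∀ j, |k j| ≤ 1) ∧ r = ∑ j, k j * v j) :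
    (s.map (gateFrequencies i)).sum ⊆
      (fun k : J → ℤ => (Pi.single i (∑ j, (k j : ℝ) * v j) : Fin d → ℝ)) ''
        {k | ∀ j, |k j| ≤ Multiset.card s} := by
  induction s using Multiset.induction_on with
  | empty =>
    intro x hx
    refine ⟨0, by simp, ?_⟩
    simpa using (by simpa using hx : x = 0).symm
  | cons H s ih =>
    rw [Multiset.map_cons, Multiset.sum_cons]
    rintro _ ⟨_, ⟨r, hr, rfl⟩, y, hy, rfl⟩
    obtain ⟨k, hk, rfl⟩ := hs H (Multiset.mem_cons_self H s) r hr
    obtain ⟨k', hk', rfl⟩ := ih (fun H' hH' => hs H' (Multiset.mem_cons_of_mem hH')) hy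
    refine ⟨k + k', fun j => ?_, ?_⟩
    · have := hk' j
      simp only [Pi.add_apply, Multiset.card_cons, Nat.cast_add, Nat.cast_one]
      linarith [abs_add_le (k j) (k' j), hk j]
    · simp only
      rw [← Pi.single_add, ← Finset.sum_add_distrib]
      congr 1
      refine Finset.sum_congr rfl fun j _ => ?_
      simp [add_mul]

/-- The frequencies are an image of the integer box of side `2 * card s + 1` in `J → ℤ`. The growth
is thus polynomial in the number of gates, with the number of generators as exponent. -/
theorem ncard_sum_gateFrequencies_le {J : Type*} [Fintype J] (v : J → ℝ) (i : Fin d)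
    (s : Multiset (HermOp n))
    (hs : ∀ H ∈ s, ∀ r ∈ diffs H, ∃ k : J → ℤ, (∀ j, |k j| ≤ 1) ∧ r = ∑ j, k j * v j) :
    ((s.map (gateFrequencies i)).sum).ncard ≤ (2 * Multiset.card s + 1) ^ Fintype.card J := by
  classical
  have hset : {k : J → ℤ | ∀ j, |k j| ≤ Multiset.card s} =
      (Fintype.piFinset fun _ : J => Finset.Icc (-(Multiset.card s : ℤ)) (Multiset.card s) :
        Set (J → ℤ)) := by
    ext k
    simp only [mem_ofPred_eq, Finset.mem_coe, Fintype.mem_piFinset, Finset.mem_Icc, abs_le]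
  have hfin : {k : J → ℤ | ∀ j, |k j| ≤ Multiset.card s}.Finite := by
    rw [hset]; exact Finset.finite_toSet _
  refine (Set.ncard_le_ncard (sum_gateFrequencies_subset v i s hs) (hfin.image _)).trans
    ((Set.ncard_image_le hfin).trans (le_of_eq ?_))
  rw [hset, Set.ncard_coe_finset, Fintype.card_piFinset, Finset.prod_const, Finset.card_univ,
    Int.card_Icc]
  congr 1
  omega

theorem ncard_sum_gateFrequencies_le_of_pauli (i : Fin d) (s : Multiset (HermOp n))
    (hs : ∀ H ∈ s, IsPauliString H) :
    ((s.map (gateFrequencies i)).sum).ncard ≤ (2 * Multiset.card s + 1) ^ 1 := by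
  refine ncard_sum_gateFrequencies_le (J := Unit) (fun _ => 2) i s fun H hH r hr => ?_
  obtain ⟨k, hk, rfl⟩ := (hs H hH).diffs_subset hr
  exact ⟨fun _ => k, fun _ => hk, by simp⟩

/-- A set of `2 T + 1` numbers that is closed under negation has at most `T` positive elements. -/
theorem ncard_diffs_pos_le {H : HermOp n} {T : ℕ} (hT : (diffs H).ncard ≤ 2 * T + 1) :
    (diffs H ∩ Ioi 0).ncard ≤ T := by
  have hneg : (diffs H ∩ Iio 0).ncard = (diffs H ∩ Ioi 0).ncard := by
    rw [← Set.ncard_image_of_injective (diffs H ∩ Ioi 0) neg_injective]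
    congr 1
    ext r
    constructor
    · rintro ⟨h1, h2⟩
      exact ⟨-r, ⟨neg_mem_diffs h1, by simpa using h2⟩, by simp⟩
    · rintro ⟨q, ⟨h1, h2⟩, rfl⟩
      exact ⟨neg_mem_diffs h1, by simpa using h2⟩
  have hfp : (diffs H ∩ Ioi 0).Finite := (diffs_finite H).inter_of_left _
  have hfn : (diffs H ∩ Iio 0).Finite := (diffs_finite H).inter_of_left _
  have h1 : ((diffs H ∩ Ioi 0) ∪ (diffs H ∩ Iio 0)).ncard =
      (diffs H ∩ Ioi 0).ncard + (diffs H ∩ Iio 0).ncard := by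
    refine Set.ncard_union_eq ?_ hfp hfn
    refine Set.disjoint_left.2 fun r hr hr' => ?_
    exact lt_asymm (show (0 : ℝ) < r from hr.2) hr'.2
  have h2 : insert 0 ((diffs H ∩ Ioi 0) ∪ (diffs H ∩ Iio 0)) ⊆ diffs H := by
    refine insert_subset (zero_mem_diffs H) (union_subset inter_subset_left inter_subset_left)
  have h3 := Set.ncard_le_ncard h2 (diffs_finite H)
  -- With `p` positive differences this reads `2 p + 1 ≤ |Δ(H)| ≤ 2 T + 1`.
  rw [Set.ncard_insert_of_notMem (by simp) (hfp.union hfn)] at h3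
  omega

/-- The generators are the positive differences: each difference is zero or plus or minus one of
them. -/
theorem ncard_sum_gateFrequencies_le_of_diffs {T : ℕ} (i : Fin d) (s : Multiset (HermOp n))
    (H₀ : HermOp n) (hs : ∀ H ∈ s, H = H₀) (hT : (diffs H₀).ncard ≤ 2 * T + 1) :
    ((s.map (gateFrequencies i)).sum).ncard ≤ (2 * Multiset.card s + 1) ^ T := by
  classical
  have hfp : (diffs H₀ ∩ Ioi 0).Finite := (diffs_finite H₀).inter_of_left _
  let _ : Fintype ↥(diffs H₀ ∩ Ioi 0) := hfp.fintype
  have hcard : Fintype.card ↥(diffs H₀ ∩ Ioi 0) ≤ T := by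
    rw [← Nat.card_eq_fintype_card]
    exact ncard_diffs_pos_le hT
  refine (ncard_sum_gateFrequencies_le (J := ↥(diffs H₀ ∩ Ioi 0)) (fun j => j.1) i s
    fun H hH r hr => ?_).trans (Nat.pow_le_pow_right (Nat.succ_pos _) hcard)
  obtain rfl := hs H hH
  have hsum : ∀ (j₀ : ↥(diffs H ∩ Ioi 0)) (e : ℤ),
      ∑ j, ((Pi.single j₀ e : ↥(diffs H ∩ Ioi 0) → ℤ) j : ℝ) * j.1 = e * j₀.1 := by
    intro j₀ e
    rw [Finset.sum_eq_single j₀] <;> simp +contextual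
  have habs : ∀ (j₀ : ↥(diffs H ∩ Ioi 0)) (e : ℤ), |e| ≤ 1 → ∀ j,
      |(Pi.single j₀ e : ↥(diffs H ∩ Ioi 0) → ℤ) j| ≤ 1 := by
    intro j₀ e he j
    rw [Pi.single_apply]
    split_ifs
    · exact he
    · simp
  rcases lt_trichotomy r 0 with h | rfl | h
  · refine ⟨Pi.single ⟨-r, neg_mem_diffs hr, by simpa using h⟩ (-1), habs _ _ (by simp), ?_⟩
    rw [hsum]; simp
  · exact ⟨0, by simp, by simp⟩
  · refine ⟨Pi.single ⟨r, hr, h⟩ 1, habs _ _ (by simp), ?_⟩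
    rw [hsum]; simp

/-- The generators are the eigenvalues themselves, a difference having coefficients `1` and `-1`.
The exponent is then linear in the number of eigenvalues, whereas the number of positive differences
can be quadratic in it. -/
theorem ncard_sum_gateFrequencies_le_of_spec {e : ℕ} (i : Fin d) (s : Multiset (HermOp n))
    (H₀ : HermOp n) (hs : ∀ H ∈ s, H = H₀) (he : (spec H₀).ncard ≤ e) :
    ((s.map (gateFrequencies i)).sum).ncard ≤ (2 * Multiset.card s + 1) ^ e := by
  classical
  let _ : Fintype ↥(spec H₀) := (spec_finite H₀).fintype
  have hcard : Fintype.card ↥(spec H₀) ≤ e := by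
    rw [← Nat.card_eq_fintype_card]
    exact he
  refine (ncard_sum_gateFrequencies_le (J := ↥(spec H₀)) (fun j => j.1) i s
    fun H hH r hr => ?_).trans (Nat.pow_le_pow_right (Nat.succ_pos _) hcard)
  obtain rfl := hs H hH
  obtain ⟨a, ha, b, hb, rfl⟩ := hr
  refine ⟨Pi.single ⟨a, ha⟩ 1 - Pi.single ⟨b, hb⟩ 1, fun j => ?_, ?_⟩
  · simp only [Pi.sub_apply, Pi.single_apply]
    split_ifs <;> simp
  · simp [Pi.single_apply, sub_mul, Finset.sum_sub_distrib]

/-- Counting bound for frequency sets whose `i`-th factor has at most `(2 Nᵢ + 1) ^ e` elements. -/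
theorem prod_le_hiddenConst_mul {e E : ℕ} (he : 1 ≤ e) (heE : e ≤ E) (k : Fin d → ℕ)
    (hk : 1 ≤ ∑ i, k i) :
    ∏ i, (2 * (k i : ℝ) + 1) ^ e ≤
      hiddenConst (3 ^ e) ((2 * d + 1) ^ (d * e) * d ^ d) d (∑ i, k i) *
        (((∑ i, k i : ℕ) : ℝ) ^ E / d) ^ d := by
  set N := ∑ i, k i with hN
  have hd : 1 ≤ d := by
    rcases Nat.eq_zero_or_pos d with rfl | h
    · simp at hN; omega
    · exact h
  have hd0 : (0 : ℝ) < d := by exact_mod_cast hd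
  have hN1 : (1 : ℝ) ≤ N := by exact_mod_cast hk
  rw [Finset.prod_pow, hiddenConst]
  split_ifs with hdN
  · have hdN' : (d : ℝ) ≤ N := by exact_mod_cast hdN
    -- AM–GM: the numbers `2 kᵢ + 1` have mean `(2N + d) / d`, which is at most `3N / d` since `d ≤
    -- N`.
    have hprod : ∏ i, (2 * (k i : ℝ) + 1) ≤ (3 * (N / d : ℝ)) ^ d := by
      have hz : ∀ i, (0 : ℝ) ≤ 2 * (k i : ℝ) + 1 := fun i => by positivity
      have ham := Real.geom_mean_le_arith_mean Finset.univ (fun _ : Fin d => (1 : ℝ))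
        (fun i => 2 * (k i : ℝ) + 1) (fun _ _ => zero_le_one) (by simpa using hd0)
        (fun i _ => hz i)
      simp only [Real.rpow_one, one_mul, Finset.sum_const, Finset.card_univ, Fintype.card_fin,
        nsmul_eq_mul, mul_one] at ham
      rw [← Real.rpow_inv_natCast_pow (Finset.prod_nonneg fun i _ => hz i) (by omega : d ≠ 0)]
      refine pow_le_pow_left₀ (Real.rpow_nonneg (Finset.prod_nonneg fun i _ => hz i) _)
        (ham.trans ?_) d
      rw [Finset.sum_add_distrib, ← Finset.mul_sum, ← Nat.cast_sum, ← hN, mul_div_assoc']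
      simp only [Finset.sum_const, Finset.card_univ, Fintype.card_fin, nsmul_eq_mul, mul_one]
      gcongr
      linarith
    -- The denominator `d ^ e` is weakened to `d` and the exponent `e` of `N` is raised to `E`,
    -- which gives the claimed shape.
    have hpow : ((N : ℝ) / d) ^ e ≤ (N : ℝ) ^ E / d := by
      rw [div_pow]
      have : (d : ℝ) ≤ (d : ℝ) ^ e := le_self_pow₀ (by exact_mod_cast hd) (by omega)
      gcongr
    calc (∏ i, (2 * (k i : ℝ) + 1)) ^ e ≤ ((3 * (N / d : ℝ)) ^ d) ^ e := by
          gcongr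
      _ = (3 ^ e) ^ d * ((N / d : ℝ) ^ e) ^ d := by
          rw [← mul_pow, ← mul_pow, ← pow_mul, ← pow_mul, mul_comm d e]
      _ ≤ _ := by gcongr
  -- Fewer gates than coordinates: each `kᵢ` is at most `d`, and the factor `d ^ d` of the constant
  -- cancels the `d` in the denominator of the target.
  · have hki : ∀ i, (k i : ℝ) ≤ d := fun i => by
      have : k i ≤ N := Finset.single_le_sum (fun _ _ => Nat.zero_le _) (Finset.mem_univ i)
      exact_mod_cast (this.trans (by omega))
    have h1 : (∏ i, (2 * (k i : ℝ) + 1)) ^ e ≤ (2 * (d : ℝ) + 1) ^ (d * e) := by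
      rw [pow_mul]
      gcongr
      refine (Finset.prod_le_prod (g := fun _ => 2 * (d : ℝ) + 1) (fun i _ => by positivity)
        fun i _ => ?_).trans (le_of_eq (by simp))
      linarith [hki i]
    have h2 : (1 : ℝ) ≤ (N : ℝ) ^ E := one_le_pow₀ hN1
    calc (∏ i, (2 * (k i : ℝ) + 1)) ^ e ≤ (2 * (d : ℝ) + 1) ^ (d * e) := h1
      _ = (2 * d + 1) ^ (d * e) * d ^ d * ((1 : ℝ) / d) ^ d := by
          rw [mul_assoc, ← mul_pow, mul_one_div_cancel hd0.ne', one_pow, mul_one]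
      _ ≤ _ := by gcongr

end Counting

/-! ### Models as trigonometric polynomials with frequencies in `Ω`. -/

section Trigonometric

variable {n d : ℕ}

/-- The exponential `x ↦ exp (i ω · x)` on the data domain. -/
def character (ω : Fin d → ℝ) (x : Inputs d) : ℂ :=
  Complex.exp (Complex.I * ∑ i, (ω i : ℂ) * ((x i : ℝ) : ℂ))

/-- Trigonometric polynomials with frequencies in `S`. -/
def trigSpan (S : Set (Fin d → ℝ)) : Submodule ℂ (Inputs d → ℂ) :=
  Submodule.span ℂ (character '' S)

theorem character_add (ω ω' : Fin d → ℝ) : character (ω + ω') = character ω * character ω' := by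
  funext x
  simp [character, ← Complex.exp_add, ← mul_add, ← Finset.sum_add_distrib, add_mul]

theorem norm_character (ω : Fin d → ℝ) (x : Inputs d) : ‖character ω x‖ = 1 := by
  have : Complex.I * ∑ i, (ω i : ℂ) * ((x i : ℝ) : ℂ) =
      ((∑ i, ω i * (x i : ℝ) : ℝ) : ℂ) * Complex.I := by
    push_cast; ring
  rw [character, this, Complex.norm_exp_ofReal_mul_I]

theorem continuous_character (ω : Fin d → ℝ) : Continuous (character ω) := by
  unfold character
  fun_prop

theorem mul_mem_trigSpan {S S' : Set (Fin d → ℝ)} {f g : Inputs d → ℂ} (hf : f ∈ trigSpan S)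
    (hg : g ∈ trigSpan S') : f * g ∈ trigSpan (S + S') := by
  have h := Submodule.mul_mem_mul hf hg
  rw [trigSpan, trigSpan, Submodule.span_mul_span] at h
  refine Submodule.span_mono ?_ h
  rintro _ ⟨_, ⟨ω, hω, rfl⟩, _, ⟨ω', hω', rfl⟩, rfl⟩
  exact ⟨ω + ω', Set.add_mem_add hω hω', character_add ω ω'⟩

theorem const_mem_trigSpan (z : ℂ) : (fun _ => z) ∈ trigSpan (0 : Set (Fin d → ℝ)) := by
  have : (fun _ => z : Inputs d → ℂ) = z • character 0 := by
    funext x; simp [character]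
  rw [this]
  exact Submodule.smul_mem _ _ (Submodule.subset_span ⟨0, rfl, rfl⟩)

theorem exp_smul_hermitian_apply (H : HermOp n) (z : ℂ) (a b : Bits n) :
    NormedSpace.exp (z • H.1) a b =
      ∑ k, (H.2.eigenvectorUnitary : Matrix (Bits n) (Bits n) ℂ) a k *
        Complex.exp (z * H.2.eigenvalues k) *
          star ((H.2.eigenvectorUnitary : Matrix (Bits n) (Bits n) ℂ) b k) := by
  set V := H.2.eigenvectorUnitary with hV
  have h1 : z • H.1 = (V : Matrix (Bits n) (Bits n) ℂ) *
      Matrix.diagonal (fun k => z * (H.2.eigenvalues k : ℂ)) *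
        (V : Matrix (Bits n) (Bits n) ℂ)⁻¹ := by
    have hinv : (V : Matrix (Bits n) (Bits n) ℂ)⁻¹ = star (V : Matrix (Bits n) (Bits n) ℂ) :=
      Matrix.inv_eq_right_inv (Unitary.mul_star_self_of_mem V.2)
    conv_lhs => rw [H.2.spectral_theorem]
    rw [Unitary.conjStarAlgAut_apply, hinv, ← Matrix.smul_mul, ← Matrix.mul_smul,
      ← Matrix.diagonal_smul]
    rfl
  have hinv : (V : Matrix (Bits n) (Bits n) ℂ)⁻¹ = star (V : Matrix (Bits n) (Bits n) ℂ) :=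
    Matrix.inv_eq_right_inv (Unitary.mul_star_self_of_mem V.2)
  have hunit : IsUnit (V : Matrix (Bits n) (Bits n) ℂ) :=
    IsUnit.of_mul_eq_one _ (Unitary.mul_star_self_of_mem V.2)
  rw [h1, Matrix.exp_conj _ _ hunit, Matrix.exp_diagonal, hinv, Matrix.mul_apply]
  refine Finset.sum_congr rfl fun k _ => ?_
  rw [Matrix.mul_diagonal, Pi.coe_exp, ← Complex.exp_eq_exp_ℂ]
  rfl

theorem exp_single_eq_character (i : Fin d) (r : ℝ) (x : Inputs d) :
    Complex.exp (Complex.I * ((x i : ℝ) : ℂ) * r) = character (Pi.single i r) x := by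
  rw [character, Finset.sum_eq_single i]
  · congr 1; simp; ring
  · intro j _ hj; simp [hj]
  · simp

theorem exp_neg_eq_character (i : Fin d) (r : ℝ) (x : Inputs d) :
    Complex.exp (-Complex.I * ((x i : ℝ) : ℂ) * r) = character (Pi.single i (-r)) x := by
  rw [← exp_single_eq_character]
  congr 1; push_cast; ring

variable {Θ : Type*}

/-- The frequencies that a gate contributes. -/
def Gate.frequencies : Gate n d Θ → Set (Fin d → ℝ)
  | .encode i H => gateFrequencies i H
  | .trainable _ => 0

/-- Conjugation by a gate adds the frequencies of the gate. -/
theorem Gate.conj_mem_trigSpan (G : Gate n d Θ) (θ : Θ) {S : Set (Fin d → ℝ)}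
    {A : Inputs d → Matrix (Bits n) (Bits n) ℂ} (hA : ∀ a b, (fun x => A x a b) ∈ trigSpan S)
    (a b : Bits n) :
    (fun x => ((G.operator θ x).conjTranspose * A x * G.operator θ x) a b) ∈
      trigSpan (S + G.frequencies) := by
  have hsum : (fun x => ((G.operator θ x).conjTranspose * A x * G.operator θ x) a b) =
      ∑ e, ∑ f, fun x => star (G.operator θ x f a) * A x f e * G.operator θ x e b := by
    funext x
    simp [Matrix.mul_apply, Finset.sum_mul]
  rw [hsum]
  refine Submodule.sum_mem _ fun e _ => Submodule.sum_mem _ fun f _ => ?_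
  cases G with
  | trainable W =>
    have h := mul_mem_trigSpan (hA f e) (const_mem_trigSpan (d := d)
      (star ((W θ : Matrix (Bits n) (Bits n) ℂ) f a) * (W θ : Matrix (Bits n) (Bits n) ℂ) e b))
    have hx : (fun x => star (Gate.operator θ x (Gate.trainable W) f a) * A x f e *
        Gate.operator θ x (Gate.trainable W) e b) = (fun x => A x f e) * fun _ =>
          star ((W θ : Matrix (Bits n) (Bits n) ℂ) f a) *
            (W θ : Matrix (Bits n) (Bits n) ℂ) e b := by
      funext x
      simp only [Gate.operator, Pi.mul_apply]
      ring
    rw [hx]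
    exact h
  | encode i H =>
    set V := (H.2.eigenvectorUnitary : Matrix (Bits n) (Bits n) ℂ) with hV
    -- Expanded in the eigenbasis, the adjoint gate contributes the eigenvalue `k` with a plus sign
    -- and the gate itself the eigenvalue `k'` with a minus sign, so only differences occur.
    have hx : (fun x => star (Gate.operator θ x (Gate.encode i H) f a) * A x f e *
        Gate.operator θ x (Gate.encode i H) e b) =
        ∑ k, ∑ k', (star (V f k) * V a k * V e k' * star (V b k')) •
          ((fun x => A x f e) *
            character (Pi.single i (H.2.eigenvalues k - H.2.eigenvalues k'))) := by
      funext x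
      have h1 : star (Gate.operator θ x (Gate.encode i H) f a) =
          ∑ k, star (V f k) * V a k * character (Pi.single i (H.2.eigenvalues k)) x := by
        simp only [Gate.operator]
        rw [exp_smul_hermitian_apply, star_sum]
        refine Finset.sum_congr rfl fun k _ => ?_
        rw [← exp_single_eq_character, star_mul', star_mul', star_star]
        have : star (Complex.exp (-Complex.I * ((x i : ℝ) : ℂ) * (H.2.eigenvalues k : ℂ))) =
            Complex.exp (Complex.I * ((x i : ℝ) : ℂ) * (H.2.eigenvalues k : ℂ)) := by
          rw [Complex.star_def, ← Complex.exp_conj]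
          simp
        rw [this]
        ring
      have h2 : Gate.operator θ x (Gate.encode i H) e b =
          ∑ k, V e k * star (V b k) * character (Pi.single i (-H.2.eigenvalues k)) x := by
        simp only [Gate.operator]
        rw [exp_smul_hermitian_apply]
        refine Finset.sum_congr rfl fun k _ => ?_
        rw [← exp_neg_eq_character]
        ring
      rw [h1, h2, Finset.sum_mul, Finset.sum_mul, Finset.sum_apply]
      refine Finset.sum_congr rfl fun k _ => ?_
      rw [Finset.mul_sum, Finset.sum_apply]
      refine Finset.sum_congr rfl fun k' _ => ?_
      simp only [Pi.smul_apply, Pi.mul_apply, smul_eq_mul]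
      rw [sub_eq_add_neg, Pi.single_add, character_add, Pi.mul_apply]
      ring
    rw [hx]
    refine Submodule.sum_mem _ fun k _ => Submodule.sum_mem _ fun k' _ =>
      Submodule.smul_mem _ _ (mul_mem_trigSpan (hA f e) (Submodule.subset_span ⟨_, ?_, rfl⟩))
    exact ⟨_, ⟨_, H.2.eigenvalues_mem_spectrum_real k, _, H.2.eigenvalues_mem_spectrum_real k',
      rfl⟩, rfl⟩

theorem Circuit.conj_mem_trigSpan (U : Circuit n d Θ) (θ : Θ) {S : Set (Fin d → ℝ)}
    {A : Inputs d → Matrix (Bits n) (Bits n) ℂ} (hA : ∀ a b, (fun x => A x a b) ∈ trigSpan S)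
    (a b : Bits n) :
    (fun x => ((U.operator θ x).conjTranspose * A x * U.operator θ x) a b) ∈
      trigSpan (S + (U.map Gate.frequencies).sum) := by
  -- The head of the list is the gate applied last, which is innermost in `U† A U`. It is absorbed
  -- into `A`, so both `A` and its frequency set must vary.
  induction U generalizing S A with
  | nil => simpa [Circuit.operator] using hA a b
  | cons G U ih =>
    have := ih (fun a b => G.conj_mem_trigSpan θ hA a b)
    rw [List.map_cons, List.sum_cons, ← add_assoc]
    have hx : ∀ x, (Circuit.operator (G :: U) θ x).conjTranspose * A x *
        Circuit.operator (G :: U) θ x = (Circuit.operator U θ x).conjTranspose *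
          ((G.operator θ x).conjTranspose * A x * G.operator θ x) * Circuit.operator U θ x := by
      intro x
      simp only [Circuit.operator, List.map_cons, List.prod_cons, Matrix.conjTranspose_mul,
        Matrix.mul_assoc]
    simp only [hx]
    exact this

/-- Minkowski addition is commutative, so the gates may be regrouped by coordinate. This is why the
order and placement of the gates do not matter. -/
theorem Circuit.sum_frequencies (U : Circuit n d Θ) :
    (U.map Gate.frequencies).sum =
      ∑ i, ((U.filterMap (Gate.hamiltonian? i)).map (gateFrequencies i)).sum := by
  induction U with
  | nil => simp
  | cons G U ih =>
    rw [List.map_cons, List.sum_cons, ih]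
    cases G with
    | trainable W =>
      rw [Gate.frequencies, zero_add]
      refine Finset.sum_congr rfl fun i _ => ?_
      rw [List.filterMap_cons_none rfl]
    | encode j H =>
      have : ∀ i, (((Gate.encode j H :: U).filterMap (Gate.hamiltonian? i)).map
          (gateFrequencies i)).sum = (if j = i then gateFrequencies i H else 0) +
            ((U.filterMap (Gate.hamiltonian? i)).map (gateFrequencies i)).sum := by
        intro i
        by_cases hij : j = i <;> simp [Gate.hamiltonian?, hij]
      simp only [this, Finset.sum_add_distrib, Finset.sum_ite_eq, Finset.mem_univ, if_true]
      rfl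

theorem Circuit.Uses.sum_frequencies {U : Circuit n d Θ} {D : Encoding n d} (h : U.Uses D) :
    (U.map Gate.frequencies).sum = D.frequencies := by
  rw [Circuit.sum_frequencies, Encoding.frequencies]
  refine Finset.sum_congr rfl fun i _ => ?_
  rw [← h i, Multiset.map_coe, Multiset.sum_coe]

theorem Circuit.Uses.output_mem_trigSpan {U : Circuit n d Θ} {D : Encoding n d} (h : U.Uses D)
    (M : HermOp n) (θ : Θ) :
    (fun x => ((U.operator θ x).conjTranspose * M.1 * U.operator θ x) 0 0) ∈
      trigSpan D.frequencies := by
  have := U.conj_mem_trigSpan θ (S := 0) (A := fun _ => M.1) (fun a b => const_mem_trigSpan _) 0 0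
  rwa [zero_add, h.sum_frequencies] at this

/-! ### Unitarity, Bessel's inequality and the linear representation of the models. -/

theorem Gate.operator_mem_unitary (G : Gate n d Θ) (θ : Θ) (x : Inputs d) :
    G.operator θ x ∈ Matrix.unitaryGroup (Bits n) ℂ := by
  cases G with
  | trainable W => exact (W θ).2
  | encode i H =>
    rw [Matrix.mem_unitaryGroup_iff', Matrix.star_eq_conjTranspose, Gate.operator,
      ← Matrix.exp_conjTranspose]
    have : ((-Complex.I * ((x i : ℝ) : ℂ)) • H.1).conjTranspose =
        -((-Complex.I * ((x i : ℝ) : ℂ)) • H.1) := by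
      rw [Matrix.conjTranspose_smul, H.2.eq, ← neg_smul]
      congr 1
      simp
    rw [this, ← Matrix.exp_add_of_commute (-((-Complex.I * ((x i : ℝ) : ℂ)) • H.1)) _
      (Commute.refl ((-Complex.I * ((x i : ℝ) : ℂ)) • H.1)).neg_left, neg_add_cancel,
      NormedSpace.exp_zero]

theorem Circuit.operator_mem_unitary (U : Circuit n d Θ) (θ : Θ) (x : Inputs d) :
    U.operator θ x ∈ Matrix.unitaryGroup (Bits n) ℂ := by
  refine list_prod_mem fun A hA => ?_
  obtain ⟨G, -, rfl⟩ := List.mem_map.1 hA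
  exact G.operator_mem_unitary θ x

/-- An entry is a coordinate of the image of a unit basis vector, and the operator norm is invariant
under multiplication by unitaries. -/
theorem norm_conj_apply_le (M : HermOp n) {U : Matrix (Bits n) (Bits n) ℂ}
    (hU : U ∈ Matrix.unitaryGroup (Bits n) ℂ) (a b : Bits n) :
    ‖(U.conjTranspose * M.1 * U) a b‖ ≤ opNorm M := by
  open scoped Matrix.Norms.L2Operator in
  have h1 : ‖(U.conjTranspose * M.1 * U) a b‖ ≤ ‖U.conjTranspose * M.1 * U‖ := by
    have h := Matrix.l2_opNorm_mulVec (U.conjTranspose * M.1 * U)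
      (EuclideanSpace.single b (1 : ℂ))
    have h' := (PiLp.norm_apply_le (WithLp.toLp 2 ((U.conjTranspose * M.1 * U).mulVec
      (EuclideanSpace.single b (1 : ℂ)).ofLp)) a).trans h
    simpa using h'
  have h2 : ‖U.conjTranspose * M.1 * U‖ = ‖M.1‖ := by
    rw [CStarRing.norm_mul_mem_unitary _ hU, ← Matrix.star_eq_conjTranspose,
      CStarRing.norm_mem_unitary_mul _ (Unitary.star_mem hU)]
  exact h1.trans h2.le

/-- Distinct integer frequencies are orthogonal on a sufficiently fine grid. -/
theorem sum_grid_eq {K : ℕ} (hK : 0 < K) (q : Fin d → ℤ) (hq : ∀ i, |q i| < K) :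
    ∑ k : Fin d → Fin K, Complex.exp (Complex.I *
      ∑ i, (q i : ℂ) * (2 * Real.pi * (k i : ℕ) / K : ℝ)) = if q = 0 then (K : ℂ) ^ d else 0 := by
  have h1 : ∀ k : Fin d → Fin K, Complex.exp (Complex.I *
      ∑ i, (q i : ℂ) * (2 * Real.pi * (k i : ℕ) / K : ℝ)) =
      ∏ i, Complex.exp (2 * Real.pi * Complex.I * (q i / K)) ^ (k i : ℕ) := by
    intro k
    rw [Finset.mul_sum, Complex.exp_sum]
    refine Finset.prod_congr rfl fun i _ => ?_
    rw [← Complex.exp_nat_mul]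
    congr 1
    push_cast
    ring
  simp only [h1]
  rw [← Fintype.piFinset_univ, ← Finset.prod_univ_sum (fun _ => Finset.univ)
    (fun i (j : Fin K) => Complex.exp (2 * Real.pi * Complex.I * (q i / K)) ^ (j : ℕ))]
  have hK0 : (K : ℂ) ≠ 0 := by exact_mod_cast hK.ne'
  split_ifs with hq0
  · simp [hq0]
  · obtain ⟨i, hi⟩ := Function.ne_iff.1 hq0
    refine Finset.prod_eq_zero (Finset.mem_univ i) ?_
    rw [Fin.sum_univ_eq_sum_range
      (fun j => Complex.exp (2 * Real.pi * Complex.I * (q i / K)) ^ j) K]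
    -- Since `0 < |q i| < K`, the integer `q i` is not a multiple of `K`. The sum is then a
    -- geometric sum over a nontrivial `K`-th root of unity.
    have hne : Complex.exp (2 * Real.pi * Complex.I * (q i / K)) ≠ 1 := by
      intro h
      obtain ⟨m, hm⟩ := Complex.exp_eq_one_iff.1 h
      have h2 : (q i : ℂ) / K = m := by
        have hpi : (2 * Real.pi * Complex.I : ℂ) ≠ 0 := Complex.two_pi_I_ne_zero
        refine mul_left_cancel₀ hpi ?_
        rw [hm]; ring
      rw [div_eq_iff hK0] at h2
      have h3 : q i = m * K := by exact_mod_cast h2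
      have h4 := hq i
      have hm0 : m ≠ 0 := by
        rintro rfl
        simp at h3
        exact hi h3
      rw [h3, abs_mul, Nat.abs_cast] at h4
      have : (1 : ℤ) ≤ |m| := Int.one_le_abs hm0
      nlinarith
    rw [geom_sum_eq hne, ← Complex.exp_nat_mul]
    have : (K : ℂ) * (2 * Real.pi * Complex.I * (q i / K)) = q i * (2 * Real.pi * Complex.I) := by
      field_simp
    rw [this, Complex.exp_int_mul_two_pi_mul_I, sub_self, zero_div]

/-- Bessel's inequality for trigonometric polynomials with integer frequencies. -/
theorem sum_norm_sq_le_of_norm_le {s : Finset (Fin d → ℝ)}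
    (hs : ∀ ω ∈ s, ∀ i, ∃ k : ℤ, ω i = k) (a : (Fin d → ℝ) → ℂ) {B : ℝ}
    (hB : ∀ x, ‖∑ ω ∈ s, a ω * character ω x‖ ≤ B) : ∑ ω ∈ s, ‖a ω‖ ^ 2 ≤ B ^ 2 := by
  classical
  obtain ⟨C, hC⟩ := (Set.Finite.isBounded s.finite_toSet).exists_norm_le
  -- With `K > 2 C`, differences of frequencies in `s` are smaller than `K` in every coordinate, so
  -- distinct ones stay orthogonal on the grid of mesh `2π / K`. This grid lies in the data domain,
  -- where the bound `B` is available.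
  obtain ⟨K, hK⟩ := exists_nat_gt (max 0 (2 * C))
  have hK0 : 0 < K := by exact_mod_cast (le_max_left _ _).trans_lt hK
  have hKC : 2 * C < K := (le_max_right _ _).trans_lt hK
  have hKr : (0 : ℝ) < K := by exact_mod_cast hK0
  set X : (Fin d → Fin K) → Inputs d := fun k i =>
    ⟨2 * Real.pi * (k i : ℕ) / K, by positivity, by
      rw [div_lt_iff₀ hKr]
      have : ((k i : ℕ) : ℝ) < K := by exact_mod_cast (k i).2
      exact mul_lt_mul_of_pos_left this Real.two_pi_pos⟩ with hX
  have horth : ∀ ω ∈ s, ∀ ω' ∈ s, ∑ k, character ω (X k) * star (character ω' (X k)) =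
      if ω = ω' then (K : ℂ) ^ d else 0 := by
    intro ω hω ω' hω'
    choose p hp using hs ω hω
    choose p' hp' using hs ω' hω'
    have h1 : ∀ k, character ω (X k) * star (character ω' (X k)) =
        Complex.exp (Complex.I * ∑ i, ((p - p') i : ℂ) * (2 * Real.pi * (k i : ℕ) / K : ℝ)) := by
      intro k
      rw [character, character, Complex.star_def, ← Complex.exp_conj, ← Complex.exp_add]
      congr 1
      simp only [map_mul, Complex.conj_I, map_sum, Complex.conj_ofReal, neg_mul, hX, hp, hp',
        Pi.sub_apply, Int.cast_sub, sub_mul, Finset.sum_sub_distrib, mul_sub]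
      simp [sub_eq_add_neg]
    simp only [h1]
    rw [sum_grid_eq hK0]
    · refine if_congr ?_ rfl rfl
      rw [sub_eq_zero, funext_iff, funext_iff]
      refine forall_congr' fun i => ?_
      rw [hp, hp']
      exact Int.cast_inj.symm
    · intro i
      have h2 : |ω i - ω' i| ≤ 2 * C := by
        have h3 := (norm_le_pi_norm ω i).trans (hC ω hω)
        have h4 := (norm_le_pi_norm ω' i).trans (hC ω' hω')
        exact (abs_sub _ _).trans (by simp only [Real.norm_eq_abs] at h3 h4; linarith)
      have h5 : |((p i - p' i : ℤ) : ℝ)| < K := by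
        push_cast
        rw [← hp, ← hp']
        exact h2.trans_lt hKC
      exact_mod_cast h5
  have hpars : ((∑ k, ‖∑ ω ∈ s, a ω * character ω (X k)‖ ^ 2 : ℝ) : ℂ) =
      ((K ^ d * ∑ ω ∈ s, ‖a ω‖ ^ 2 : ℝ) : ℂ) := by
    push_cast
    calc ∑ k, (‖∑ ω ∈ s, a ω * character ω (X k)‖ : ℂ) ^ 2
        = ∑ k, ∑ ω ∈ s, ∑ ω' ∈ s,
            a ω * star (a ω') * (character ω (X k) * star (character ω' (X k))) := by
          refine Finset.sum_congr rfl fun k _ => ?_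
          rw [← Complex.mul_conj', map_sum, Finset.sum_mul_sum]
          refine Finset.sum_congr rfl fun ω _ => Finset.sum_congr rfl fun ω' _ => ?_
          simp only [map_mul, Complex.star_def]
          ring
      _ = ∑ ω ∈ s, ∑ ω' ∈ s, a ω * star (a ω') *
            ∑ k, (character ω (X k) * star (character ω' (X k))) := by
          rw [Finset.sum_comm]
          refine Finset.sum_congr rfl fun ω _ => ?_
          rw [Finset.sum_comm]
          refine Finset.sum_congr rfl fun ω' _ => ?_
          rw [Finset.mul_sum]
      _ = ∑ ω ∈ s, a ω * star (a ω) * (K : ℂ) ^ d := by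
          refine Finset.sum_congr rfl fun ω hω => ?_
          rw [Finset.sum_eq_single_of_mem ω hω, horth ω hω ω hω, if_pos rfl]
          intro ω' hω' hne
          rw [horth ω hω ω' hω', if_neg hne.symm, mul_zero]
      _ = _ := by
          rw [Finset.mul_sum]
          refine Finset.sum_congr rfl fun ω _ => ?_
          rw [Complex.star_def, Complex.mul_conj', mul_comm]
  have hpars' : ∑ k, ‖∑ ω ∈ s, a ω * character ω (X k)‖ ^ 2 =
      (K : ℝ) ^ d * ∑ ω ∈ s, ‖a ω‖ ^ 2 := by exact_mod_cast hpars
  have hle : ∑ k, ‖∑ ω ∈ s, a ω * character ω (X k)‖ ^ 2 ≤ (K : ℝ) ^ d * B ^ 2 := by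
    refine (Finset.sum_le_sum fun k _ =>
      pow_le_pow_left₀ (norm_nonneg _) (hB (X k)) 2).trans (le_of_eq ?_)
    simp
  rw [hpars'] at hle
  exact le_of_mul_le_mul_left hle (by positivity)

/-- Vectors with integer coordinates form an additive submonoid, which is therefore preserved by
Minkowski sums. -/
theorem Encoding.frequencies_integer {D : Encoding n d}
    (hD : ∀ i, ∀ H ∈ D i, HasIntegerFrequencies H) :
    ∀ ω ∈ D.frequencies, ∀ i, ∃ k : ℤ, ω i = k := by
  set Γ : AddSubmonoid (Fin d → ℝ) :=
    { carrier := {ω | ∀ i, ∃ k : ℤ, ω i = k}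
      zero_mem' := fun i => ⟨0, by simp⟩
      add_mem' := fun {ω ω'} h h' i => by
        obtain ⟨k, hk⟩ := h i
        obtain ⟨k', hk'⟩ := h' i
        exact ⟨k + k', by simp [hk, hk']⟩ } with hΓ
  have hadd : ∀ A B : Set (Fin d → ℝ), A ⊆ Γ → B ⊆ Γ → A + B ⊆ Γ := by
    rintro A B hA hB _ ⟨a, ha, b, hb, rfl⟩
    exact Γ.add_mem (hA ha) (hB hb)
  have hzero : (0 : Set (Fin d → ℝ)) ⊆ Γ := by
    rintro _ rfl
    exact Γ.zero_mem
  have hgate : ∀ i, ∀ H ∈ D i, gateFrequencies i H ⊆ Γ := by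
    rintro i H hH _ ⟨r, hr, rfl⟩ j
    obtain ⟨k, rfl⟩ := hD i H hH r hr
    by_cases hij : j = i
    · subst hij; exact ⟨k, by simp⟩
    · exact ⟨0, by simp [hij]⟩
  have : D.frequencies ⊆ Γ := by
    refine Finset.sum_induction _ (fun A : Set (Fin d → ℝ) => A ⊆ Γ) hadd hzero fun i _ => ?_
    refine Multiset.sum_induction (fun A : Set (Fin d → ℝ) => A ⊆ Γ) _ hadd hzero fun A hA => ?_
    obtain ⟨H, hH, rfl⟩ := Multiset.mem_map.1 hA
    exact hgate i H hH
  exact this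

/-- The models are linear in the feature map of all exponentials with frequencies in `Ω`, with
weights bounded by the norm of the observable. -/
theorem exists_weights_of_mem_modelClass {D : Encoding n d} {M : HermOp n}
    (hD : ∀ i, ∀ H ∈ D i, HasIntegerFrequencies H) {f : Inputs d → ℝ}
    (hf : f ∈ modelClass Θ D M) :
    ∃ v : EuclideanSpace ℂ D.frequencies_finite.toFinset, ‖v‖ ≤ opNorm M ∧
      ∀ x, f x = inner ℝ v (WithLp.toLp 2 fun ω => character ω.1 x) := by
  classical
  obtain ⟨U, θ, hU, rfl⟩ := hf
  have hspan := hU.output_mem_trigSpan M θ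
  set s := D.frequencies_finite.toFinset with hs
  have hsc : (D.frequencies : Set (Fin d → ℝ)) = s := by simp [hs]
  rw [trigSpan, hsc, Submodule.mem_span_image_finset_iff_exists_fun'] at hspan
  obtain ⟨a, ha⟩ := hspan
  have hax : ∀ x, ((U.operator θ x).conjTranspose * M.1 * U.operator θ x) 0 0 =
      ∑ ω ∈ s, a ω * character ω x := fun x => by
    rw [← congrFun ha x]
    simp
  have hM : 0 ≤ opNorm M := norm_nonneg _
  have hbes := sum_norm_sq_le_of_norm_le (s := s) (B := opNorm M)
    (fun ω hω => Encoding.frequencies_integer hD ω (by rw [hsc]; exact hω)) a (fun x => by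
      rw [← hax]
      exact norm_conj_apply_le M (U.operator_mem_unitary θ x) 0 0)
  -- The real inner product conjugates its first argument and takes the real part, so conjugated
  -- coefficients reproduce `re (∑ a ω * character ω x)`.
  refine ⟨WithLp.toLp 2 fun ω => star (a ω.1), ?_, fun x => ?_⟩
  · rw [EuclideanSpace.norm_eq]
    refine Real.sqrt_le_iff.2 ⟨hM, ?_⟩
    simp only [norm_star]
    rw [Finset.sum_coe_sort s fun ω => ‖a ω‖ ^ 2]
    exact hbes
  · rw [Circuit.output, hax, Complex.re_sum, PiLp.inner_apply,
      ← Finset.sum_coe_sort s fun ω => (a ω * character ω x).re]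
    refine Finset.sum_congr rfl fun ω _ => ?_
    simp [Complex.inner]
    ring

/-- The generalization bound for integer frequencies. -/
theorem gapBound_modelClass {D : Encoding n d} {M : HermOp n}
    (hD : ∀ i, ∀ H ∈ D i, HasIntegerFrequencies H) {m : ℕ} (hm : 1 ≤ m) {c : ℝ}
    {L : NNReal} {l : ℝ → ℝ → ℝ} (hlm : Measurable fun p : ℝ × ℝ => l p.1 p.2)
    (hl : ∀ y z, l y z ∈ Set.Icc 0 c) (hlip : ∀ y, LipschitzWith L (l y))
    (P : Measure (Inputs d × ℝ)) [IsProbabilityMeasure P] {δ : ℝ} (hδ : δ ∈ Set.Ioo (0 : ℝ) 1) :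
    GapBound (modelClass Θ D M) l P m δ
      (2 * (L * opNorm M / Real.sqrt m * Real.sqrt (D.frequencies.ncard : ℝ) +
        c * Real.sqrt (Real.log (1 / δ) / m))) := by
  refine gapBound_of_linear (E := EuclideanSpace ℂ D.frequencies_finite.toFinset)
    (φ := fun x => WithLp.toLp 2 fun ω => character ω.1 x) hm hlm hl hlip P hδ (norm_nonneg _)
    (Real.sqrt_nonneg _) (fun x => ?_) (fun v => ?_)
    (fun f hf => exists_weights_of_mem_modelClass hD hf)
  -- Every character has modulus one, so the feature vector has norm exactly `√|Ω|`.
  · rw [EuclideanSpace.norm_eq]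
    refine Real.sqrt_le_sqrt (le_of_eq ?_)
    simp [norm_character, Set.ncard_eq_toFinset_card _ D.frequencies_finite]
  · simp only [PiLp.inner_apply]
    refine Continuous.measurable (continuous_finsetSum _ fun ω _ => ?_)
    exact continuous_const.inner (continuous_character ω.1)

end Trigonometric

/-! ### Assembly of the counting and generalization bounds. -/

theorem GapBound.mono {d m : ℕ} {F : Set (Inputs d → ℝ)} {l : ℝ → ℝ → ℝ}
    {P : Measure (Inputs d × ℝ)} {δ ε ε' : ℝ} (h : GapBound F l P m δ ε) (hε : ε ≤ ε') :
    GapBound F l P m δ ε' :=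
  h.trans (measure_mono fun _ hS f hf => (hS f hf).trans hε)

/-- If the `i`-th factor of the frequency set has at most `(2 Nᵢ + 1) ^ e` elements, then the
frequency set is as small as claimed, and the generalization bound follows. -/
theorem ncard_le_and_gapBound {Θ : Type*} {n d : ℕ} {D : Encoding n d} {M : HermOp n}
    (hD : ∀ i, ∀ H ∈ D i, HasIntegerFrequencies H) {e E : ℕ} (he : 1 ≤ e) (heE : e ≤ E)
    (hN : 1 ≤ D.numGates)
    (hcard : ∀ i, (((D i).map (gateFrequencies i)).sum).ncard ≤
      (2 * Multiset.card (D i) + 1) ^ e) {m : ℕ} (hm : 1 ≤ m) {c : ℝ}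
    {L : NNReal} {l : ℝ → ℝ → ℝ} (hlm : Measurable fun p : ℝ × ℝ => l p.1 p.2)
    (hl : ∀ y z, l y z ∈ Set.Icc 0 c) (hlip : ∀ y, LipschitzWith L (l y))
    (P : Measure (Inputs d × ℝ)) [IsProbabilityMeasure P] {δ : ℝ} (hδ : δ ∈ Set.Ioo (0 : ℝ) 1) :
    (D.frequencies.ncard : ℝ) ≤
        hiddenConst (2 * 3 ^ e) (2 * ((2 * d + 1) ^ (d * e) * d ^ d)) d D.numGates *
          ((D.numGates : ℝ) ^ E / d) ^ d ∧
      GapBound (modelClass Θ D M) l P m δ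
        (hiddenConst (2 * 3 ^ e) (2 * ((2 * d + 1) ^ (d * e) * d ^ d)) d D.numGates *
            (L * opNorm M / Real.sqrt m * ((D.numGates : ℝ) ^ E / d) ^ ((d : ℝ) / 2)) +
          2 * (c * Real.sqrt (Real.log (1 / δ) / m))) := by
  have hd : 1 ≤ d := by
    rcases Nat.eq_zero_or_pos d with rfl | h
    · simp [Encoding.numGates] at hN
    · exact h
  have hd1 : (1 : ℝ) ≤ d := by exact_mod_cast hd
  set X : ℝ := (D.numGates : ℝ) ^ E / d with hX
  have hX0 : 0 ≤ X := by positivity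
  set K := hiddenConst (3 ^ e) ((2 * d + 1) ^ (d * e) * d ^ d) d D.numGates with hK
  set K' := hiddenConst (2 * 3 ^ e) (2 * ((2 * d + 1) ^ (d * e) * d ^ d)) d D.numGates with hK'
  have hcount : (D.frequencies.ncard : ℝ) ≤ K * X ^ d := by
    refine le_trans ?_ (prod_le_hiddenConst_mul he heE (fun i => Multiset.card (D i)) hN)
    refine (Nat.cast_le.2 (D.ncard_frequencies_le_prod.trans
      (Finset.prod_le_prod' fun i _ => hcard i))).trans (le_of_eq ?_)
    push_cast
    rfl
  -- This gives `√K ≤ K`, so one constant serves both the count and the bound containing its square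
  -- root.
  have hK1 : 1 ≤ K := by
    rw [hK, hiddenConst]
    split_ifs
    · exact one_le_pow₀ (one_le_pow₀ (by norm_num))
    · exact one_le_mul_of_one_le_of_one_le (one_le_pow₀ (by linarith)) (one_le_pow₀ hd1)
  -- The universal factor `2` of `gapBound_modelClass` is absorbed into the constant; in the branch
  -- `A ^ d` this uses `1 ≤ d`.
  have hKK' : 2 * K ≤ K' := by
    rw [hK, hK', hiddenConst, hiddenConst]
    split_ifs
    · rw [mul_pow]
      gcongr
      exact le_self_pow₀ (by norm_num) (by omega)
    · exact le_rfl
  refine ⟨hcount.trans (mul_le_mul_of_nonneg_right (by linarith) (by positivity)), ?_⟩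
  refine (gapBound_modelClass (Θ := Θ) (M := M) hD hm hlm hl hlip P hδ).mono ?_
  have hsqrt : Real.sqrt (D.frequencies.ncard : ℝ) ≤ K * X ^ ((d : ℝ) / 2) := by
    have h1 : Real.sqrt (X ^ d) = X ^ ((d : ℝ) / 2) := by
      rw [Real.sqrt_eq_rpow, ← Real.rpow_natCast, ← Real.rpow_mul hX0]
      congr 1
      ring
    have h2 : Real.sqrt K ≤ K := Real.sqrt_le_iff.2 ⟨by linarith, le_self_pow₀ hK1 two_ne_zero⟩
    calc _ ≤ Real.sqrt (K * X ^ d) := Real.sqrt_le_sqrt hcount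
      _ = Real.sqrt K * X ^ ((d : ℝ) / 2) := by rw [Real.sqrt_mul (by linarith), h1]
      _ ≤ _ := by gcongr
  have hY : 0 ≤ L * opNorm M / Real.sqrt m :=
    div_nonneg (mul_nonneg L.2 (norm_nonneg _)) (Real.sqrt_nonneg _)
  have hXr : 0 ≤ X ^ ((d : ℝ) / 2) := Real.rpow_nonneg hX0 _
  have h3 := mul_le_mul_of_nonneg_left hsqrt hY
  have h4 := mul_le_mul_of_nonneg_right hKK' (mul_nonneg hY hXr)
  linarith

end PQC

end

theorem mainTheorem1 :
    ∃ (C A₁ : ℝ) (B₁ : ℕ → ℝ) (A₂ : ℕ → ℝ) (B₂ : ℕ → ℕ → ℝ) (A₃ : ℕ → ℝ) (B₃ : ℕ → ℕ → ℝ),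
      ∀ (Θ : Type*) (n d : ℕ) (D : PQC.Encoding n d) (M : PQC.HermOp n)
        (m : ℕ) (_ : 1 ≤ m)
        (c : ℝ) (L : NNReal) (l : ℝ → ℝ → ℝ)
        (_ : Measurable (fun p : ℝ × ℝ => l p.1 p.2))
        (_ : ∀ y z, l y z ∈ Set.Icc 0 c)
        (_ : ∀ y, LipschitzWith L (l y))
        (P : MeasureTheory.Measure (PQC.Inputs d × ℝ)) (_ : MeasureTheory.IsProbabilityMeasure P)
        (δ : ℝ) (_ : δ ∈ Set.Ioo (0 : ℝ) 1),
        -- any strategy with integer frequencies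
        ((∀ i, ∀ H ∈ D i, PQC.HasIntegerFrequencies H) →
          PQC.GapBound (PQC.modelClass Θ D M) l P m δ
            (C * (L * PQC.opNorm M / Real.sqrt m * Real.sqrt (D.frequencies.ncard : ℝ)
              + c * Real.sqrt (Real.log (1 / δ) / m)))) ∧
        -- Pauli encodings
        (1 ≤ D.numGates → (∀ i, ∀ H ∈ D i, PQC.IsPauliString H) →
          (D.frequencies.ncard : ℝ)
            ≤ PQC.hiddenConst A₁ (B₁ d) d D.numGates * ((D.numGates : ℝ) / d) ^ d ∧
          PQC.GapBound (PQC.modelClass Θ D M) l P m δ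
            (PQC.hiddenConst A₁ (B₁ d) d D.numGates *
                (L * PQC.opNorm M / Real.sqrt m * ((D.numGates : ℝ) / d) ^ ((d : ℝ) / 2))
              + C * (c * Real.sqrt (Real.log (1 / δ) / m)))) ∧
        -- one repeated Hamiltonian per coordinate, with frequencies `0, ±δ₁, …, ±δ_T`
        (∀ T : ℕ, 1 ≤ T → 1 ≤ D.numGates →
          (∀ i, ∃ H₀ : PQC.HermOp n, (∀ H ∈ D i, H = H₀) ∧ PQC.HasIntegerFrequencies H₀ ∧
            (PQC.diffs H₀).ncard ≤ 2 * T + 1) →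
          (D.frequencies.ncard : ℝ)
            ≤ PQC.hiddenConst (A₂ T) (B₂ T d) d D.numGates *
                ((D.numGates : ℝ) ^ (2 * T - 1) / d) ^ d ∧
          PQC.GapBound (PQC.modelClass Θ D M) l P m δ
            (PQC.hiddenConst (A₂ T) (B₂ T d) d D.numGates *
                (L * PQC.opNorm M / Real.sqrt m *
                  ((D.numGates : ℝ) ^ (2 * T - 1) / d) ^ ((d : ℝ) / 2))
              + C * (c * Real.sqrt (Real.log (1 / δ) / m)))) ∧
        -- one repeated `κ`-local Hamiltonian per coordinate
        (∀ κ : ℕ, 1 ≤ D.numGates →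
          (∀ i, ∃ H₀ : PQC.HermOp n, (∀ H ∈ D i, H = H₀) ∧ PQC.HasIntegerFrequencies H₀ ∧
            PQC.IsLocal κ H₀) →
          (D.frequencies.ncard : ℝ)
            ≤ PQC.hiddenConst (A₃ κ) (B₃ κ d) d D.numGates *
                ((D.numGates : ℝ) ^ (2 ^ (κ + 1) - 1) / d) ^ d ∧
          PQC.GapBound (PQC.modelClass Θ D M) l P m δ
            (PQC.hiddenConst (A₃ κ) (B₃ κ d) d D.numGates *
                (L * PQC.opNorm M / Real.sqrt m *
                  ((D.numGates : ℝ) ^ (2 ^ (κ + 1) - 1) / d) ^ ((d : ℝ) / 2))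
              + C * (c * Real.sqrt (Real.log (1 / δ) / m)))) ∧
        -- possibly different `κ`-local Hamiltonians
        (∀ κ : ℕ,
          (∀ i, ∀ H ∈ D i, PQC.HasIntegerFrequencies H ∧ PQC.IsLocal κ H) →
          (D.frequencies.ncard : ℝ) ≤ (2 : ℝ) ^ (2 * κ * D.numGates) ∧
          PQC.GapBound (PQC.modelClass Θ D M) l P m δ
            (C * (L * PQC.opNorm M / Real.sqrt m * (2 : ℝ) ^ (κ * D.numGates)
              + c * Real.sqrt (Real.log (1 / δ) / m)))) := by
  -- The constants are those of `ncard_le_and_gapBound` with exponent `e` equal to `1`, `T` and `2 ^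
  -- κ` respectively.
  refine ⟨2, 2 * 3 ^ 1, fun d => 2 * ((2 * d + 1) ^ (d * 1) * d ^ d), fun T => 2 * 3 ^ T,
    fun T d => 2 * ((2 * d + 1) ^ (d * T) * d ^ d), fun κ => 2 * 3 ^ 2 ^ κ,
    fun κ d => 2 * ((2 * d + 1) ^ (d * 2 ^ κ) * d ^ d), ?_⟩
  intro Θ n d D M m hm c L l hlm hl hlip P hP δ hδ
  have hmain := fun hD => PQC.gapBound_modelClass (Θ := Θ) (D := D) (M := M) hD hm hlm hl hlip P hδ
  refine ⟨hmain, fun hN hD => ?_, fun T hT hN hD => ?_, fun κ hN hD => ?_, fun κ hD => ?_⟩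
  · have := PQC.ncard_le_and_gapBound (Θ := Θ) (D := D) (M := M) (e := 1) (E := 1)
      (fun i H hH => (hD i H hH).hasIntegerFrequencies) le_rfl le_rfl hN
      (fun i => PQC.ncard_sum_gateFrequencies_le_of_pauli i (D i) (hD i)) hm hlm hl hlip P hδ
    rwa [pow_one (D.numGates : ℝ)] at this
  · choose H₀ hH₀ hint hT' using hD
    exact PQC.ncard_le_and_gapBound (fun i H hH => hH₀ i H hH ▸ hint i) hT (by omega) hN
      (fun i => PQC.ncard_sum_gateFrequencies_le_of_diffs i (D i) (H₀ i) (hH₀ i) (hT' i))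
      hm hlm hl hlip P hδ
  · choose H₀ hH₀ hint hloc using hD
    have h1 : 1 ≤ 2 ^ κ := Nat.one_le_two_pow
    exact PQC.ncard_le_and_gapBound (fun i H hH => hH₀ i H hH ▸ hint i) h1
      (by rw [pow_succ]; omega) hN
      (fun i => PQC.ncard_sum_gateFrequencies_le_of_spec i (D i) (H₀ i) (hH₀ i)
        (hloc i).ncard_spec_le) hm hlm hl hlip P hδ
  -- Different Hamiltonians need not share generators, so each gate contributes a full factor
  -- `|Δ(H)| ≤ |spec H|² ≤ 2 ^ (2κ)`.
  · have hcount : (D.frequencies.ncard : ℝ) ≤ (2 : ℝ) ^ (2 * κ * D.numGates) := by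
      have h := D.ncard_frequencies_le_pow (K := 2 ^ (2 * κ)) fun i H hH =>
        (PQC.ncard_diffs_le H).trans ((Nat.pow_le_pow_left (hD i H hH).2.ncard_spec_le 2).trans
          (le_of_eq (by rw [← pow_mul, mul_comm])))
      rw [← pow_mul] at h
      exact_mod_cast h
    refine ⟨hcount, (hmain fun i H hH => (hD i H hH).1).mono ?_⟩
    have hsqrt : Real.sqrt (D.frequencies.ncard : ℝ) ≤ (2 : ℝ) ^ (κ * D.numGates) := by
      refine Real.sqrt_le_iff.2 ⟨by positivity, hcount.trans (le_of_eq ?_)⟩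
      rw [← pow_mul]
      congr 1
      ring
    have hY : 0 ≤ L * PQC.opNorm M / Real.sqrt m :=
      div_nonneg (mul_nonneg L.2 (norm_nonneg _)) (Real.sqrt_nonneg _)
    have := mul_le_mul_of_nonneg_left hsqrt hY
    linarith
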